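/- Conventions. Manifolds are smooth, finite-dimensional, Hausdorff and without boundary; all maps, sections and functions are smooth. Let $\tau\colon E\to M$ be a Lie algebroid with anchor $\rho$ and bracket $[\cdot,\cdot]$. For a submersion $\nu\colon P\to M$ the prolongation $\mathcal T^EP\to P$ is the Lie algebroid with fibre $\mathcal T^E_pP=\{(b,v)\in E_{\nu(p)}\times T_pP:\rho(b)=T_p\nu(v)\}$, anchor $(b,v)\mapsto v$, and bracket $[(\sigma_1,U_1),(\sigma_2,U_2)]=([\sigma_1,\sigma_2],[U_1,U_2])$ on projectable sections $p\mapsto(\sigma_i(\nu(p)),U_i(p))$. On $\mathcal T^EE^*$ let $\Theta$ be the Liouville section, $\langle\Theta,(\mu,b,w)\rangle=\langle\mu,b\rangle$, and $\Omega=-d\Theta$ the canonical symplectic section, where $d$ is the exterior differential of the Lie algebroid $\mathcal T^EE^*$. An optimal control system on $E$ consists of a submersion $\pi\colon B\to M$, a section $\sigma\colon B\to E$ of $E$ along $\pi$, and an index function $L\colon B\to\mathbb R$. Put $H(\mu,u)=\langle\mu,\sigma(u)\rangle-L(u)$ on $E^*\times_MB$, let $\mathrm{pr}_1\colon E^*\times_MB\to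 E^*$ be the projection, with prolongation $\mathcal T\mathrm{pr}_1(b,v)=(b,T\mathrm{pr}_1(v))$, let $\langle dH,(b,v)\rangle=v(H)$ on $\mathcal T^E(E^*\times_MB)$, and let $$S_H=\{q\in E^*\times_MB:\ \langle dH(q),y\rangle=0\text{ for all }y\in\mathcal T^E_q(E^*\times_MB)\text{ with }\mathcal T\mathrm{pr}_1(y)=0\}.$$ For $q\in S_H$ let the critical section $\sigma_H(q)\in\mathcal T^E_{\mathrm{pr}_1(q)}E^*$ be the solution $z$ of the symplectic equation $\Omega(z,\mathcal T\mathrm{pr}_1(y))=\langle dH(q),y\rangle$ for all $y\in\mathcal T^E_q(E^*\times_MB)$. A critical trajectory (Pontryagin extremal) of class $C^r$, $0\le r\le\infty$, is a $C^r$ curve $\gamma$ in $E^*\times_MB$, defined on a nondegenerate interval, that lies in $S_H$ and such that $\mathrm{pr}_1\circ\gamma$ is differentiable with $\frac{d}{dt}(\mathrm{pr}_1\circ\gamma)(t)=\rho(\sigma_H(\gamma(t)))$. Theorem. Let $(B,E,M,\sigma,L)$ and $(B',E',M',\sigma',L')$ be optimal control systems on Lie algebroids. Let $\Phi\colon E\to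 E'$ be a fiberwise bijective morphism of Lie algebroids over $\varphi\colon M\to M'$, and let $\psi\colon B\to B'$ be a map fibered over the same $\varphi$ that is fiberwise submersive, i.e. $T_u\psi$ maps $\ker T_u\pi$ onto $\ker T_{\psi(u)}\pi'$ for every $u\in B$. Assume that $\Phi\circ\sigma=\sigma'\circ\psi$ and $L=L'\circ\psi$. Let $\Phi^c\colon E^*\to E'^*$, $\langle\Phi^c(\mu),a\rangle=\langle\mu,\Phi_m^{-1}(a)\rangle$ for $\mu\in E^*_m$, $a\in E'_{\varphi(m)}$, be the contragredient map, put $\Psi(\mu,u)=(\Phi^c(\mu),\psi(u))$ and $\mathcal T^\Phi\Phi^c(\mu,b,w)=(\Phi^c(\mu),\Phi(b),T\Phi^c(w))$. Then: 1. the symplectic equations of both systems have exactly one solution at every point of $S_H$, respectively of $S_{H'}$, so that $\sigma_H$ and $\sigma_{H'}$ are well defined there; 2. $\Psi(S_H)\subset S_{H'}$; 3. $\mathcal T^\Phi\Phi^c\circ\sigma_H=\sigma_{H'}\circ\Psi$ on $S_H$; 4. the image under $\Psi$ of every critical trajectory (of class $C^r$) of the first system is a critical trajectory (of class $C^r$)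 of the second. -/

import Mathlib

open Bundle Set
open scoped Manifold ContDiff

noncomputable section

namespace AlgebroidControl

set_option linter.unusedSectionVars false

/-! ### Lie algebroids, their exterior differential, and their morphisms -/

section LieAlgebroid

variable {V : Type*} [NormedAddCommGroup V] [NormedSpace ℝ V]
  {M : Type*} [TopologicalSpace M] [ChartedSpace V M]
  {F : Type*} [NormedAddCommGroup F] [NormedSpace ℝ F]
  {E : M → Type*} [∀ x, AddCommGroup (E x)] [∀ x, Module ℝ (E x)]
  [∀ x, TopologicalSpace (E x)] [TopologicalSpace (TotalSpace F E)]
  [FiberBundle F E] [VectorBundle ℝ F E]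

/-- The derivative `v f = df(v)` of a real function `f` on a manifold along a tangent vector `v`. -/
def dirDeriv {W : Type*} [NormedAddCommGroup W] [NormedSpace ℝ W]
    {H : Type*} [TopologicalSpace H] (I : ModelWithCorners ℝ W H)
    {P : Type*} [TopologicalSpace P] [ChartedSpace H P] (f : P → ℝ) (p : P)
    (v : TangentSpace I p) : ℝ :=
  mfderiv I 𝓘(ℝ, ℝ) f p v

/-- Smooth sections of the vector bundle `E → M` (with typical fibre `F`, and `M` modelled
on `V`). -/
abbrev Sec (V : Type*) [NormedAddCommGroup V] [NormedSpace ℝ V]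
    {M : Type*} [TopologicalSpace M] [ChartedSpace V M]
    (F : Type*) [NormedAddCommGroup F] [NormedSpace ℝ F]
    (E : M → Type*) [∀ x, AddCommGroup (E x)] [∀ x, Module ℝ (E x)]
    [∀ x, TopologicalSpace (E x)] [TopologicalSpace (TotalSpace F E)]
    [FiberBundle F E] [VectorBundle ℝ F E] :=
  ContMDiffSection 𝓘(ℝ, V) F ∞ E

/-- The product `f σ` of a smooth function and a smooth section. -/
def smulSec (f : C^∞⟮𝓘(ℝ, V), M; 𝓘(ℝ, ℝ), ℝ⟯) (σ : Sec V F E) : Sec V F E :=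
  ⟨fun x => f x • σ x, f.contMDiff.smul_section σ.contMDiff⟩

/-- A Lie algebroid structure on the vector bundle `E → M`: a smooth vector bundle map
`ρ : E → TM` over the identity, and a real Lie algebra structure on the sections of `E`, with
`[σ, f η] = (ρ(σ) f) η + f [σ, η]`. -/
structure LieAlgebroid (V : Type*) [NormedAddCommGroup V] [NormedSpace ℝ V]
    {M : Type*} [TopologicalSpace M] [ChartedSpace V M] [IsManifold 𝓘(ℝ, V) ∞ M]
    (F : Type*) [NormedAddCommGroup F] [NormedSpace ℝ F]
    (E : M → Type*) [∀ x, AddCommGroup (E x)] [∀ x, Module ℝ (E x)]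
    [∀ x, TopologicalSpace (E x)] [TopologicalSpace (TotalSpace F E)]
    [FiberBundle F E] [VectorBundle ℝ F E] where
  anchor : ∀ x : M, E x →L[ℝ] TangentSpace 𝓘(ℝ, V) x
  smooth_anchor : ContMDiff (𝓘(ℝ, V).prod 𝓘(ℝ, F)) 𝓘(ℝ, V).tangent ∞
    (fun z : TotalSpace F E => (⟨z.proj, anchor z.proj z.snd⟩ : TangentBundle 𝓘(ℝ, V) M))
  bracket : Sec V F E →ₗ[ℝ] Sec V F E →ₗ[ℝ] Sec V F E
  bracket_self : ∀ σ, bracket σ σ = 0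
  jacobi : ∀ σ η ζ, bracket σ (bracket η ζ) = bracket (bracket σ η) ζ + bracket η (bracket σ ζ)
  leibniz : ∀ (σ η : Sec V F E) (f : C^∞⟮𝓘(ℝ, V), M; 𝓘(ℝ, ℝ), ℝ⟯) (x : M),
    bracket σ (smulSec f η) x =
      dirDeriv 𝓘(ℝ, V) f x (anchor x (σ x)) • η x + f x • bracket σ η x

/-- A (pointwise) `p`-form on `E`: an alternating `p`-linear form on every fibre. -/
abbrev Form {M : Type*} (E : M → Type*) [∀ x, AddCommGroup (E x)] [∀ x, Module ℝ (E x)]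
    (p : ℕ) :=
  ∀ x : M, E x [⋀^Fin p]→ₗ[ℝ] ℝ

/-- Smoothness of a `p`-form, i.e. `θ ∈ Sec(∧ᵖ E*)`: its values on smooth sections are smooth. -/
def IsSmoothForm (V F : Type*) [NormedAddCommGroup V] [NormedSpace ℝ V]
    {M : Type*} [TopologicalSpace M] [ChartedSpace V M] [NormedAddCommGroup F] [NormedSpace ℝ F]
    {E : M → Type*} [∀ x, AddCommGroup (E x)] [∀ x, Module ℝ (E x)]
    [∀ x, TopologicalSpace (E x)] [TopologicalSpace (TotalSpace F E)]
    [FiberBundle F E] [VectorBundle ℝ F E] {p : ℕ} (θ : Form E p) : Prop :=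
  ∀ s : Fin p → Sec V F E, ContMDiff 𝓘(ℝ, V) 𝓘(ℝ, ℝ) ∞ (fun x => θ x (fun i => s i x))

variable [IsManifold 𝓘(ℝ, V) ∞ M]

namespace LieAlgebroid

/-- The derivative `ρ(σ) f` of a function along a section. -/
def lieD (A : LieAlgebroid V F E) (σ : Sec V F E) (f : M → ℝ) (x : M) : ℝ :=
  dirDeriv 𝓘(ℝ, V) f x (A.anchor x (σ x))

/-- The second sum `∑_{i<j} (-1)^{i+j} θ([s_i, s_j], s_0, …, ŝ_i, …, ŝ_j, …, s_p)` in the formula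
for the exterior differential; the first of the two indices is `i.castSucc`, and the omitted
entries are removed one after the other. -/
def bracketSum (A : LieAlgebroid V F E) :
    {p : ℕ} → Form E p → (Fin (p + 1) → Sec V F E) → M → ℝ
  | 0, _, _, _ => 0
  | k + 1, θ, s, x =>
      ∑ j : Fin (k + 2), ∑ i : Fin (k + 1),
        if i.castSucc < j then
          (-1 : ℝ) ^ ((i : ℕ) + (j : ℕ)) *
            θ x (Fin.cons (A.bracket (s i.castSucc) (s j) x)
              (fun l : Fin k => s (j.succAbove (i.succAbove l)) x))
        else 0

/-- The exterior differential `dθ(s_0, …, s_p)` of a `p`-form, evaluated on sections. -/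
def extD (A : LieAlgebroid V F E) {p : ℕ} (θ : Form E p) (s : Fin (p + 1) → Sec V F E)
    (x : M) : ℝ :=
  (∑ i : Fin (p + 1),
    (-1 : ℝ) ^ (i : ℕ) * A.lieD (s i) (fun y => θ y (fun l => s (i.succAbove l) y)) x)
  + A.bracketSum θ s x

end LieAlgebroid

variable {V' : Type*} [NormedAddCommGroup V'] [NormedSpace ℝ V']
  {M' : Type*} [TopologicalSpace M'] [ChartedSpace V' M'] [IsManifold 𝓘(ℝ, V') ∞ M']
  {F' : Type*} [NormedAddCommGroup F'] [NormedSpace ℝ F']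
  {E' : M' → Type*} [∀ x, AddCommGroup (E' x)] [∀ x, Module ℝ (E' x)]
  [∀ x, TopologicalSpace (E' x)] [TopologicalSpace (TotalSpace F' E')]
  [FiberBundle F' E'] [VectorBundle ℝ F' E']

/-- A smooth vector bundle map `Φ : E → E'` over the smooth map `φ : M → M'`. -/
structure BundleMap {V : Type*} [NormedAddCommGroup V] [NormedSpace ℝ V]
    {M : Type*} [TopologicalSpace M] [ChartedSpace V M]
    {V' : Type*} [NormedAddCommGroup V'] [NormedSpace ℝ V']
    {M' : Type*} [TopologicalSpace M'] [ChartedSpace V' M']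
    (F : Type*) [NormedAddCommGroup F] [NormedSpace ℝ F]
    (E : M → Type*) [∀ x, AddCommGroup (E x)] [∀ x, Module ℝ (E x)]
    [∀ x, TopologicalSpace (E x)] [TopologicalSpace (TotalSpace F E)]
    [FiberBundle F E] [VectorBundle ℝ F E]
    (F' : Type*) [NormedAddCommGroup F'] [NormedSpace ℝ F']
    (E' : M' → Type*) [∀ x, AddCommGroup (E' x)] [∀ x, Module ℝ (E' x)]
    [∀ x, TopologicalSpace (E' x)] [TopologicalSpace (TotalSpace F' E')]
    [FiberBundle F' E'] [VectorBundle ℝ F' E']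
    (φ : C^∞⟮𝓘(ℝ, V), M; 𝓘(ℝ, V'), M'⟯) where
  onFiber : ∀ x : M, E x →L[ℝ] E' (φ x)
  smooth : ContMDiff (𝓘(ℝ, V).prod 𝓘(ℝ, F)) (𝓘(ℝ, V').prod 𝓘(ℝ, F')) ∞
    (fun z : TotalSpace F E => (⟨φ z.proj, onFiber z.proj z.snd⟩ : TotalSpace F' E'))

namespace BundleMap

variable {φ : C^∞⟮𝓘(ℝ, V), M; 𝓘(ℝ, V'), M'⟯}

/-- The pull-back `Φ⋆θ` of a form. -/
def pullbackForm (Φ : BundleMap F E F' E' φ) {p : ℕ} (θ : Form E' p) : Form E p :=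
  fun x => (θ (φ x)).compLinearMap (Φ.onFiber x : E x →ₗ[ℝ] E' (φ x))

/-- `Φ` is a morphism of Lie algebroids: `Φ⋆(dθ) = d(Φ⋆θ)` for every smooth `p`-form `θ` on `E'`,
for every `p`. The two sides are compared on sections `s_i` of `E` at the point `x`; the values
`Φ (s_i x)` are extended to sections `t_i` of `E'`, so as to evaluate `dθ`. -/
def IsMorphism (A : LieAlgebroid V F E) (A' : LieAlgebroid V' F' E')
    (Φ : BundleMap F E F' E' φ) : Prop :=
  ∀ (p : ℕ) (θ : Form E' p), IsSmoothForm V' F' θ →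
    ∀ (s : Fin (p + 1) → Sec V F E) (t : Fin (p + 1) → Sec V' F' E') (x : M),
      (∀ i, t i (φ x) = Φ.onFiber x (s i x)) →
        A'.extD θ t (φ x) = A.extD (Φ.pullbackForm θ) s x

/-- `Φ` is bijective on every fibre. -/
def FiberwiseBijective (Φ : BundleMap F E F' E' φ) : Prop :=
  ∀ x, Function.Bijective (Φ.onFiber x)

end BundleMap

end LieAlgebroid

/-! ### The prolongation of a fibration with respect to a Lie algebroid -/

section Prolongation

variable {V : Type*} [NormedAddCommGroup V] [NormedSpace ℝ V]
  {M : Type*} [TopologicalSpace M] [ChartedSpace V M] [IsManifold 𝓘(ℝ, V) ∞ M]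
  {F : Type*} [NormedAddCommGroup F] [NormedSpace ℝ F]
  {E : M → Type*} [∀ x, AddCommGroup (E x)] [∀ x, Module ℝ (E x)]
  [∀ x, TopologicalSpace (E x)] [TopologicalSpace (TotalSpace F E)]
  [FiberBundle F E] [VectorBundle ℝ F E]
  {W : Type*} [NormedAddCommGroup W] [NormedSpace ℝ W]
  {H : Type*} [TopologicalSpace H] (I : ModelWithCorners ℝ W H)
  {P : Type*} [TopologicalSpace P] [ChartedSpace H P] [IsManifold I ∞ P]

/-- The fibre at `p` of the prolongation `𝒯ᴱP` of `ν : P → M`: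
the pairs `(b, v) ∈ E_{ν(p)} × T_pP` with `ρ(b) = T_pν(v)`. -/
def prol (A : LieAlgebroid V F E) (ν : P → M) (p : P) :
    Submodule ℝ (E (ν p) × TangentSpace I p) where
  carrier := {z | A.anchor (ν p) z.1 = mfderiv I 𝓘(ℝ, V) ν p z.2}
  add_mem' := by
    intro a b (ha : A.anchor (ν p) a.1 = _) (hb : A.anchor (ν p) b.1 = _)
    change A.anchor (ν p) (a.1 + b.1) = mfderiv I 𝓘(ℝ, V) ν p (a.2 + b.2)
    rw [map_add, map_add, ha, hb]
  zero_mem' := by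
    change A.anchor (ν p) 0 = mfderiv I 𝓘(ℝ, V) ν p 0
    rw [map_zero, map_zero]
  smul_mem' := by
    intro c a (ha : A.anchor (ν p) a.1 = _)
    change A.anchor (ν p) (c • a.1) = mfderiv I 𝓘(ℝ, V) ν p (c • a.2)
    rw [map_smul, map_smul, ha]

/-- A projectable section `Z(p) = (σ(ν(p)), U(p))` of `𝒯ᴱP`, with `σ` a section of `E` and `U` a
vector field on `P`. -/
structure ProjectableSection (A : LieAlgebroid V F E) (ν : P → M) where
  base : Sec V F E
  field : ContMDiffSection I W ∞ (fun p : P => TangentSpace I p)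
  mem : ∀ p, (base (ν p), field p) ∈ prol I A ν p

namespace ProjectableSection

variable {I} {A : LieAlgebroid V F E} {ν : P → M}

/-- The value of a projectable section at a point. -/
def val (Z : ProjectableSection I A ν) (p : P) : prol I A ν p :=
  ⟨(Z.base (ν p), Z.field p), Z.mem p⟩

/-- The bracket of two projectable sections, `p ↦ ([σ₁, σ₂](ν(p)), [U₁, U₂](p))`. -/
def bracket (Z₁ Z₂ : ProjectableSection I A ν) (p : P) : E (ν p) × TangentSpace I p :=
  (A.bracket Z₁.base Z₂.base (ν p),
    VectorField.mlieBracket I (fun q => Z₁.field q) (fun q => Z₂.field q) p)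

instance : Nonempty (ProjectableSection I A ν) :=
  ⟨⟨0, 0, fun _ => Submodule.zero_mem _⟩⟩

end ProjectableSection

/-- The exterior differential of the Lie algebroid `𝒯ᴱP` (whose anchor is `(b, v) ↦ v`) applied to
a one-form `θ`, evaluated on projectable sections:
`dθ(Z₁, Z₂) = ρ(Z₁)⟨θ, Z₂⟩ - ρ(Z₂)⟨θ, Z₁⟩ - ⟨θ, [Z₁, Z₂]⟩`.
The form is given by linear functionals on the ambient spaces `E_{ν(p)} × T_pP` of the fibres. -/
def prolExtD {A : LieAlgebroid V F E} {ν : P → M}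
    (θ : ∀ p : P, (E (ν p) × TangentSpace I p) →ₗ[ℝ] ℝ)
    (Z₁ Z₂ : ProjectableSection I A ν) (p : P) : ℝ :=
  dirDeriv I (fun q => θ q (Z₂.val q)) p (Z₁.field p)
  - dirDeriv I (fun q => θ q (Z₁.val q)) p (Z₂.field p)
  - θ p (Z₁.bracket Z₂ p)

/-- The value at `p` of the two-form `dθ` on `z₁, z₂` in the fibre of `𝒯ᴱP` at `p`: evaluate it on
projectable sections that take the values `z₁`, `z₂` at `p`. -/
def prolExtDAt {A : LieAlgebroid V F E} {ν : P → M}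
    (θ : ∀ p : P, (E (ν p) × TangentSpace I p) →ₗ[ℝ] ℝ) (p : P) (z₁ z₂ : prol I A ν p) : ℝ :=
  prolExtD I θ (Classical.epsilon (fun Z : ProjectableSection I A ν => Z.val p = z₁))
    (Classical.epsilon (fun Z : ProjectableSection I A ν => Z.val p = z₂)) p

end Prolongation

/-! ### The dual bundle and its canonical symplectic section -/

section Dual

variable (V : Type*) [NormedAddCommGroup V] [NormedSpace ℝ V]
  {M : Type*} [TopologicalSpace M] [ChartedSpace V M] [IsManifold 𝓘(ℝ, V) ∞ M]
  (F : Type*) [NormedAddCommGroup F] [NormedSpace ℝ F]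
  (E : M → Type*) [∀ x, AddCommGroup (E x)] [∀ x, Module ℝ (E x)]
  [∀ x, TopologicalSpace (E x)] [TopologicalSpace (TotalSpace F E)]
  [FiberBundle F E] [VectorBundle ℝ F E] [ContMDiffVectorBundle ∞ F E 𝓘(ℝ, V)]

/-- The fibres of the dual bundle `E*`. -/
abbrev DualFib {M : Type*} (E : M → Type*) [∀ x, AddCommGroup (E x)] [∀ x, Module ℝ (E x)]
    [∀ x, TopologicalSpace (E x)] (x : M) := E x →L[ℝ] Bundle.Trivial M ℝ x

/-- The total space of the dual bundle `E*`, a smooth manifold. -/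
abbrev DualTot {M : Type*} (F : Type*) [NormedAddCommGroup F] [NormedSpace ℝ F]
    (E : M → Type*) [∀ x, AddCommGroup (E x)] [∀ x, Module ℝ (E x)]
    [∀ x, TopologicalSpace (E x)] := TotalSpace (F →L[ℝ] ℝ) (DualFib E)

/-- The model of the manifold `E*`. -/
abbrev dualModel := 𝓘(ℝ, V).prod 𝓘(ℝ, F →L[ℝ] ℝ)

variable {V F E}

/-- The Liouville section `⟨Θ, (μ, b, w)⟩ = ⟨μ, b⟩` of the dual of `𝒯ᴱE*`. -/
def liouville (μ : DualTot F E) : (E μ.proj × TangentSpace (dualModel V F) μ) →ₗ[ℝ] ℝ where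
  toFun z := μ.snd z.1
  map_add' a b := μ.snd.map_add a.1 b.1
  map_smul' c a := μ.snd.map_smul c a.1

/-- The canonical symplectic section `Ω = -dΘ` of `𝒯ᴱE*`. -/
def canonicalForm (A : LieAlgebroid V F E) (μ : DualTot F E)
    (z₁ z₂ : prol (dualModel V F) A (TotalSpace.proj : DualTot F E → M) μ) : ℝ :=
  - prolExtDAt (dualModel V F) liouville μ z₁ z₂

end Dual

/-! ### Optimal control systems on a Lie algebroid -/

section Control

variable {V : Type*} [NormedAddCommGroup V] [NormedSpace ℝ V]
  {M : Type*} [TopologicalSpace M] [ChartedSpace V M] [IsManifold 𝓘(ℝ, V) ∞ M]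
  {F : Type*} [NormedAddCommGroup F] [NormedSpace ℝ F]
  {E : M → Type*} [∀ x, AddCommGroup (E x)] [∀ x, Module ℝ (E x)]
  [∀ x, TopologicalSpace (E x)] [TopologicalSpace (TotalSpace F E)]
  [FiberBundle F E] [VectorBundle ℝ F E] [ContMDiffVectorBundle ∞ F E 𝓘(ℝ, V)]
  {U : Type*} [NormedAddCommGroup U] [NormedSpace ℝ U]
  {B : Type*} [TopologicalSpace B] [ChartedSpace U B] [IsManifold 𝓘(ℝ, U) ∞ B]

/-- The smooth map `ϖ` is a submersion (between finite-dimensional manifolds). -/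
def IsSubmersive {V : Type*} [NormedAddCommGroup V] [NormedSpace ℝ V]
    {M : Type*} [TopologicalSpace M] [ChartedSpace V M]
    {U : Type*} [NormedAddCommGroup U] [NormedSpace ℝ U]
    {B : Type*} [TopologicalSpace B] [ChartedSpace U B]
    (ϖ : C^∞⟮𝓘(ℝ, U), B; 𝓘(ℝ, V), M⟯) : Prop :=
  ∀ u, Function.Surjective (mfderiv 𝓘(ℝ, U) 𝓘(ℝ, V) ϖ u)

/-- An optimal control system with control space `ϖ : B → M`: a smooth section `σ` of `E`
along `ϖ`, and a smooth index function `L` on `B`. -/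
structure ControlSystem {V : Type*} [NormedAddCommGroup V] [NormedSpace ℝ V]
    {M : Type*} [TopologicalSpace M] [ChartedSpace V M]
    (F : Type*) [NormedAddCommGroup F] [NormedSpace ℝ F]
    (E : M → Type*) [∀ x, AddCommGroup (E x)] [∀ x, Module ℝ (E x)]
    [∀ x, TopologicalSpace (E x)] [TopologicalSpace (TotalSpace F E)]
    [FiberBundle F E] [VectorBundle ℝ F E]
    {U : Type*} [NormedAddCommGroup U] [NormedSpace ℝ U]
    {B : Type*} [TopologicalSpace B] [ChartedSpace U B]
    (ϖ : C^∞⟮𝓘(ℝ, U), B; 𝓘(ℝ, V), M⟯) where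
  section_ : ∀ u : B, E (ϖ u)
  smooth_section : ContMDiff 𝓘(ℝ, U) (𝓘(ℝ, V).prod 𝓘(ℝ, F)) ∞
    (fun u => (⟨ϖ u, section_ u⟩ : TotalSpace F E))
  index : C^∞⟮𝓘(ℝ, U), B; 𝓘(ℝ, ℝ), ℝ⟯

/-- The manifold `E* ×_M B`, realised as the pull-back of the bundle `E* → M` along `ϖ : B → M`:
a point `q` consists of `q.proj : B` and `q.snd : (E (ϖ q.proj))*`. -/
abbrev ControlTot (F : Type*) [NormedAddCommGroup F] [NormedSpace ℝ F]
    {M : Type*} (E : M → Type*) [∀ x, AddCommGroup (E x)] [∀ x, Module ℝ (E x)]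
    [∀ x, TopologicalSpace (E x)]
    {V : Type*} [NormedAddCommGroup V] [NormedSpace ℝ V]
    [TopologicalSpace M] [ChartedSpace V M]
    {U : Type*} [NormedAddCommGroup U] [NormedSpace ℝ U]
    {B : Type*} [TopologicalSpace B] [ChartedSpace U B]
    (ϖ : C^∞⟮𝓘(ℝ, U), B; 𝓘(ℝ, V), M⟯) := TotalSpace (F →L[ℝ] ℝ) (ϖ *ᵖ (DualFib E))

/-- The model of the manifold `E* ×_M B`. -/
abbrev controlModel (U F : Type*) [NormedAddCommGroup U] [NormedSpace ℝ U]
    [NormedAddCommGroup F] [NormedSpace ℝ F] := 𝓘(ℝ, U).prod 𝓘(ℝ, F →L[ℝ] ℝ)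

variable {ϖ : C^∞⟮𝓘(ℝ, U), B; 𝓘(ℝ, V), M⟯}

/-- The projection `E* ×_M B → M`. -/
def baseProj (ϖ : C^∞⟮𝓘(ℝ, U), B; 𝓘(ℝ, V), M⟯) (q : ControlTot F E ϖ) : M := ϖ q.proj

/-- The first projection `pr₁ : E* ×_M B → E*`. -/
def pr₁ (q : ControlTot F E ϖ) : DualTot F E := ⟨ϖ q.proj, q.snd⟩

lemma contMDiff_pr₁ : ContMDiff (controlModel U F) (dualModel V F) ∞
    (pr₁ : ControlTot F E ϖ → DualTot F E) := by
  intro q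
  have h : ContMDiffAt (controlModel U F) (controlModel U F) ∞
    (id : ControlTot F E ϖ → ControlTot F E ϖ) q := contMDiffAt_id
  rw [contMDiffAt_totalSpace] at h ⊢
  exact ⟨ϖ.contMDiff.contMDiffAt.comp q h.1, h.2⟩

lemma prolPr₁_mem (A : LieAlgebroid V F E) (q : ControlTot F E ϖ)
    (y : prol (controlModel U F) A (baseProj ϖ) q) :
    ((y.1.1, mfderiv (controlModel U F) (dualModel V F) pr₁ q y.1.2) :
      E (pr₁ q).proj × TangentSpace (dualModel V F) (pr₁ q)) ∈
      prol (dualModel V F) A (TotalSpace.proj : DualTot F E → M) (pr₁ q) := by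
  have h₁ : MDifferentiableAt (controlModel U F) (dualModel V F)
      (pr₁ : ControlTot F E ϖ → DualTot F E) q :=
    contMDiff_pr₁.mdifferentiableAt (by simp)
  have h₂ : MDifferentiableAt (dualModel V F) 𝓘(ℝ, V)
      (TotalSpace.proj : DualTot F E → M) (pr₁ q) :=
    (contMDiff_proj (n := ∞) (DualFib E)).mdifferentiableAt (by simp)
  have h₃ := mfderiv_comp_apply q h₂ h₁ y.1.2
  exact (show A.anchor (ϖ q.proj) y.1.1 = _ from y.2).trans h₃

/-- The prolongation `𝒯pr₁ : 𝒯ᴱ(E* ×_M B) → 𝒯ᴱE*`, `(q, b, v) ↦ (pr₁(q), b, T pr₁(v))`. -/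
def prolPr₁ (A : LieAlgebroid V F E) (q : ControlTot F E ϖ)
    (y : prol (controlModel U F) A (baseProj ϖ) q) :
    prol (dualModel V F) A (TotalSpace.proj : DualTot F E → M) (pr₁ q) :=
  ⟨(y.1.1, mfderiv (controlModel U F) (dualModel V F) pr₁ q y.1.2), prolPr₁_mem A q y⟩

namespace ControlSystem

/-- The Hamiltonian `H(μ, u) = ⟨μ, σ(u)⟩ - L(u)` on `E* ×_M B`. -/
def hamiltonian (C : ControlSystem F E ϖ) (q : ControlTot F E ϖ) : ℝ :=
  (pr₁ q).snd (C.section_ q.proj) - C.index q.proj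

/-- The differential `dH` in the Lie algebroid `𝒯ᴱ(E* ×_M B)`: `⟨dH, (q, b, v)⟩ = v H`. -/
def dHamiltonian (A : LieAlgebroid V F E) (C : ControlSystem F E ϖ) (q : ControlTot F E ϖ)
    (y : prol (controlModel U F) A (baseProj ϖ) q) : ℝ :=
  dirDeriv (controlModel U F) C.hamiltonian q y.1.2

/-- The set `S_H` of points at which `dH` vanishes on `ker 𝒯pr₁`. -/
def criticalSet (A : LieAlgebroid V F E) (C : ControlSystem F E ϖ) : Set (ControlTot F E ϖ) :=
  {q | ∀ y : prol (controlModel U F) A (baseProj ϖ) q,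
    prolPr₁ A q y = 0 → C.dHamiltonian A q y = 0}

/-- The symplectic equation `i_z Ω = dH` at the point `q`, for an element `z` of the fibre of
`𝒯ᴱE*` at `pr₁(q)`. -/
def SymplecticEq (A : LieAlgebroid V F E) (C : ControlSystem F E ϖ) (q : ControlTot F E ϖ)
    (z : prol (dualModel V F) A (TotalSpace.proj : DualTot F E → M) (pr₁ q)) : Prop :=
  ∀ y : prol (controlModel U F) A (baseProj ϖ) q,
    canonicalForm A (pr₁ q) z (prolPr₁ A q y) = C.dHamiltonian A q y

/-- The critical section `σ_H`, a section of `𝒯ᴱE*` along `pr₁`: the solution of the symplectic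
equation (meaningful at points of `S_H`, where the solution exists and is unique). -/
def criticalSection (A : LieAlgebroid V F E) (C : ControlSystem F E ϖ) (q : ControlTot F E ϖ) :
    prol (dualModel V F) A (TotalSpace.proj : DualTot F E → M) (pr₁ q) :=
  Classical.epsilon (C.SymplecticEq A q)

/-- A critical trajectory of class `C^r` on the interval `J`: a curve `γ` in `E* ×_M B` that lies
in `S_H` and is an integral curve of the vector field `ρ(σ_H)` along `pr₁`, i.e. the tangent
vector of `pr₁ ∘ γ` at `t` is `ρ(σ_H(γ(t)))`. -/
structure IsCriticalTrajectory (A : LieAlgebroid V F E) (C : ControlSystem F E ϖ) (r : ℕ∞)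
    (J : Set ℝ) (γ : ℝ → ControlTot F E ϖ) : Prop where
  interval : J.OrdConnected
  nontrivial : J.Nontrivial
  regular : ContMDiffOn 𝓘(ℝ, ℝ) (controlModel U F) r γ J
  mem_criticalSet : ∀ t ∈ J, γ t ∈ C.criticalSet A
  tangent : ∀ t ∈ J, HasMFDerivWithinAt 𝓘(ℝ, ℝ) (dualModel V F) (fun s => pr₁ (γ s)) J t
    ((1 : ℝ →L[ℝ] ℝ).smulRight (C.criticalSection A (γ t)).1.2)

end ControlSystem

end Control

/-! ### The maps induced by a fibrewise bijective morphism -/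

section Reduction

variable {V : Type*} [NormedAddCommGroup V] [NormedSpace ℝ V]
  {M : Type*} [TopologicalSpace M] [ChartedSpace V M] [IsManifold 𝓘(ℝ, V) ∞ M]
  {F : Type*} [NormedAddCommGroup F] [NormedSpace ℝ F] [FiniteDimensional ℝ F]
  {E : M → Type*} [∀ x, AddCommGroup (E x)] [∀ x, Module ℝ (E x)]
  [∀ x, TopologicalSpace (E x)] [TopologicalSpace (TotalSpace F E)]
  [FiberBundle F E] [VectorBundle ℝ F E] [ContMDiffVectorBundle ∞ F E 𝓘(ℝ, V)]
  {U : Type*} [NormedAddCommGroup U] [NormedSpace ℝ U]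
  {B : Type*} [TopologicalSpace B] [ChartedSpace U B] [IsManifold 𝓘(ℝ, U) ∞ B]
  {V' : Type*} [NormedAddCommGroup V'] [NormedSpace ℝ V']
  {M' : Type*} [TopologicalSpace M'] [ChartedSpace V' M'] [IsManifold 𝓘(ℝ, V') ∞ M']
  {F' : Type*} [NormedAddCommGroup F'] [NormedSpace ℝ F'] [FiniteDimensional ℝ F']
  {E' : M' → Type*} [∀ x, AddCommGroup (E' x)] [∀ x, Module ℝ (E' x)]
  [∀ x, TopologicalSpace (E' x)] [TopologicalSpace (TotalSpace F' E')]
  [FiberBundle F' E'] [VectorBundle ℝ F' E'] [ContMDiffVectorBundle ∞ F' E' 𝓘(ℝ, V')]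
  {U' : Type*} [NormedAddCommGroup U'] [NormedSpace ℝ U']
  {B' : Type*} [TopologicalSpace B'] [ChartedSpace U' B'] [IsManifold 𝓘(ℝ, U') ∞ B']
  {φ : C^∞⟮𝓘(ℝ, V), M; 𝓘(ℝ, V'), M'⟯}
  {ϖ : C^∞⟮𝓘(ℝ, U), B; 𝓘(ℝ, V), M⟯} {ϖ' : C^∞⟮𝓘(ℝ, U'), B'; 𝓘(ℝ, V'), M'⟯}

/-- The inverse of a continuous linear bijection between fibres is continuous. -/
lemma continuous_fiber_inverse (F F' : Type*) [NormedAddCommGroup F] [NormedSpace ℝ F]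
    [NormedAddCommGroup F'] [NormedSpace ℝ F'] [FiniteDimensional ℝ F']
    [TopologicalSpace (TotalSpace F E)] [FiberBundle F E] [VectorBundle ℝ F E]
    [TopologicalSpace (TotalSpace F' E')] [FiberBundle F' E'] [VectorBundle ℝ F' E']
    (x : M) (x' : M') (f : E x →L[ℝ] E' x')
    (hf : Function.Bijective f) :
    Continuous (LinearEquiv.ofBijective (f : E x →ₗ[ℝ] E' x') hf).symm := by
  let e := VectorBundle.continuousLinearEquivAt ℝ F E x
  let e' := VectorBundle.continuousLinearEquivAt ℝ F' E' x'
  let g := (LinearEquiv.ofBijective (f : E x →ₗ[ℝ] E' x') hf).symm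
  have h : Continuous ((e : E x →ₗ[ℝ] F) ∘ₗ (g : E' x' →ₗ[ℝ] E x) ∘ₗ (e'.symm : F' →ₗ[ℝ] E' x')) :=
    LinearMap.continuous_of_finiteDimensional _
  have h' := e.symm.continuous.comp (h.comp e'.continuous)
  refine h'.congr fun v => ?_
  simp [g]

namespace BundleMap

/-- The inverse `Φ_x⁻¹ : E'_{φ(x)} → E_x` of a fibrewise bijective bundle map. -/
def fiberInv (Φ : BundleMap F E F' E' φ) (hΦ : Φ.FiberwiseBijective) (x : M) :
    E' (φ x) →L[ℝ] E x :=
  ⟨(LinearEquiv.ofBijective (Φ.onFiber x : E x →ₗ[ℝ] E' (φ x)) (hΦ x)).symm,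
    continuous_fiber_inverse F F' x (φ x) (Φ.onFiber x) (hΦ x)⟩

/-- The contragredient map `Φᶜ : E* → E'*`, `⟨Φᶜ(μ), a⟩ = ⟨μ, Φ_x⁻¹(a)⟩`. -/
def contragredient (Φ : BundleMap F E F' E' φ) (hΦ : Φ.FiberwiseBijective) (μ : DualTot F E) :
    DualTot F' E' :=
  ⟨φ μ.proj, μ.snd.comp (Φ.fiberInv hΦ μ.proj)⟩

/-- The prolongation `𝒯^Φ Φᶜ : 𝒯ᴱE* → 𝒯^{E'}E'*`, `(μ, b, w) ↦ (Φᶜ(μ), Φ(b), T Φᶜ(w))`, as a triple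
consisting of a point of `E'*`, an element of the fibre of `E'` below it, and a tangent vector. -/
def prolContragredient (A : LieAlgebroid V F E) (Φ : BundleMap F E F' E' φ)
    (hΦ : Φ.FiberwiseBijective) (μ : DualTot F E)
    (z : prol (dualModel V F) A (TotalSpace.proj : DualTot F E → M) μ) :
    Σ μ' : DualTot F' E', E' μ'.proj × TangentSpace (dualModel V' F') μ' :=
  ⟨Φ.contragredient hΦ μ, Φ.onFiber μ.proj z.1.1,
    mfderiv (dualModel V F) (dualModel V' F') (Φ.contragredient hΦ) μ z.1.2⟩

/-- The map `Ψ = (Φᶜ, ψ) : E* ×_M B → E'* ×_{M'} B'`, for `ψ : B → B'` over the same base map. -/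
def controlMap (Φ : BundleMap F E F' E' φ) (hΦ : Φ.FiberwiseBijective)
    (ψ : C^∞⟮𝓘(ℝ, U), B; 𝓘(ℝ, U'), B'⟯) (hψ : ∀ u, ϖ' (ψ u) = φ (ϖ u))
    (q : ControlTot F E ϖ) : ControlTot F' E' ϖ' :=
  ⟨ψ q.proj, show DualFib E' (ϖ' (ψ q.proj)) from
    (hψ q.proj).symm ▸ (Φ.contragredient hΦ (pr₁ q)).snd⟩

lemma controlMap_proj (Φ : BundleMap F E F' E' φ) (hΦ : Φ.FiberwiseBijective)
    (ψ : C^∞⟮𝓘(ℝ, U), B; 𝓘(ℝ, U'), B'⟯) (hψ : ∀ u, ϖ' (ψ u) = φ (ϖ u))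
    (q : ControlTot F E ϖ) : (Φ.controlMap hΦ ψ hψ q).proj = ψ q.proj := rfl

lemma pr₁_controlMap (Φ : BundleMap F E F' E' φ) (hΦ : Φ.FiberwiseBijective)
    (ψ : C^∞⟮𝓘(ℝ, U), B; 𝓘(ℝ, U'), B'⟯) (hψ : ∀ u, ϖ' (ψ u) = φ (ϖ u))
    (q : ControlTot F E ϖ) :
    pr₁ (Φ.controlMap hΦ ψ hψ q) = Φ.contragredient hΦ (pr₁ q) := by
  have key : ∀ (x' : M') (h : x' = φ (ϖ q.proj)),
      (⟨x', h.symm ▸ (Φ.contragredient hΦ (pr₁ q)).snd⟩ : DualTot F' E') =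
        Φ.contragredient hΦ (pr₁ q) := by
    rintro x' rfl
    rfl
  exact key _ (hψ q.proj)

end BundleMap

/-- The map `ψ : B → B'` is fibrewise submersive: at every point its tangent map sends the vectors
tangent to the fibre of `B → M` onto the vectors tangent to the fibre of `B' → M'`. -/
def FiberwiseSubmersive (ϖ : C^∞⟮𝓘(ℝ, U), B; 𝓘(ℝ, V), M⟯) (ϖ' : C^∞⟮𝓘(ℝ, U'), B'; 𝓘(ℝ, V'), M'⟯)
    (ψ : C^∞⟮𝓘(ℝ, U), B; 𝓘(ℝ, U'), B'⟯) : Prop :=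
  ∀ (u : B) (w : TangentSpace 𝓘(ℝ, U') (ψ u)), mfderiv 𝓘(ℝ, U') 𝓘(ℝ, V') ϖ' (ψ u) w = 0 →
    ∃ v : TangentSpace 𝓘(ℝ, U) u, mfderiv 𝓘(ℝ, U) 𝓘(ℝ, V) ϖ u v = 0 ∧
      mfderiv 𝓘(ℝ, U) 𝓘(ℝ, U') ψ u v = w

end Reduction

end AlgebroidControl

/-! The theorem holds because `𝒯^Φ Φᶜ` is a fibrewise symplectic isomorphism and `H = H' ∘ Ψ`.

For `zᵢ = (bᵢ, wᵢ)` at `μ` and any sections `σᵢ` of `E` through `bᵢ`, the canonical form is `Ω(z₁,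
z₂) = w₂⟨·, σ₁⟩ - w₁⟨·, σ₂⟩ + ⟨μ, [σ₁, σ₂]⟩` (`canonicalForm_eq`). The anchor condition defining the
prolongation makes this tensorial in each `σᵢ`. Testing against vertical and horizontal elements
shows that `Ω` is nondegenerate (`canonicalBilin_injective`). At a point of `S_H` the functional
`dH` descends along the surjection `𝒯pr₁`, so the symplectic equation has exactly one solution
(`existsUnique_symplecticEq`).

In degree 0 the morphism condition says that `Φ` intertwines the anchors (`anchor_onFiber`). In
degree 1 it says that `Φ` intertwines the brackets of sections of `E'` with those of their
pull-backs (`onFiber_bracket_pullbackSec`). Since `⟨·, t⟩ ∘ Φᶜ` is the fibre-linear function of the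
pull-back of `t`, all three terms of `Ω` match (`canonicalForm_prolMap`), and a dimension count
makes `𝒯^Φ Φᶜ` bijective on fibres (`prolMap_bijective`), whatever the dimensions of `M` and `M'`.

Fibrewise submersivity of `ψ` lifts `ker 𝒯pr₁` at `Ψ(q)` to `ker 𝒯pr₁` at `q`, which gives `Ψ(S_H) ⊆
S_{H'}` (`controlMap_mem_criticalSet`). Then `𝒯^Φ Φᶜ(σ_H(q))` solves the symplectic equation at
`Ψ(q)` (`symplecticEq_controlMap`), and uniqueness identifies it with `σ_{H'}(Ψ(q))`. The statement
on trajectories is the chain rule. -/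

namespace AlgebroidControl

set_option linter.unusedSectionVars false

/-! ### Derivatives on total spaces of fibre bundles, in the preferred charts. -/

section TotalSpaceDeriv

variable {EB : Type*} [NormedAddCommGroup EB] [NormedSpace ℝ EB] {HB : Type*} [TopologicalSpace HB]
  {IB : ModelWithCorners ℝ EB HB} {B : Type*} [TopologicalSpace B] [ChartedSpace HB B]
  {F : Type*} [NormedAddCommGroup F] [NormedSpace ℝ F] {E : B → Type*}
  [TopologicalSpace (TotalSpace F E)] [∀ x, TopologicalSpace (E x)] [FiberBundle F E]
  {EN : Type*} [NormedAddCommGroup EN] [NormedSpace ℝ EN] {HN : Type*} [TopologicalSpace HN]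
  {IN : ModelWithCorners ℝ EN HN} {N : Type*} [TopologicalSpace N] [ChartedSpace HN N]

lemma extChartAt_totalSpace_apply (p z : TotalSpace F E) :
    extChartAt (IB.prod 𝓘(ℝ, F)) p z =
      (extChartAt IB p.proj (trivializationAt F E p.proj z).1,
        (trivializationAt F E p.proj z).2) := by
  rw [FiberBundle.extChartAt]; rfl

lemma extChartAt_totalSpace_apply_of_mem {p z : TotalSpace F E}
    (hz : z ∈ (trivializationAt F E p.proj).source) :
    extChartAt (IB.prod 𝓘(ℝ, F)) p z =
      (extChartAt IB p.proj z.proj, (trivializationAt F E p.proj z).2) := by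
  rw [extChartAt_totalSpace_apply, Trivialization.coe_fst _ hz]

lemma extChartAt_totalSpace_symm {p : TotalSpace F E} {y : EB × F}
    (hy : y ∈ (extChartAt (IB.prod 𝓘(ℝ, F)) p).target) :
    (extChartAt IB p.proj ((extChartAt (IB.prod 𝓘(ℝ, F)) p).symm y).proj,
      (trivializationAt F E p.proj ((extChartAt (IB.prod 𝓘(ℝ, F)) p).symm y)).2) = y := by
  rw [← extChartAt_totalSpace_apply_of_mem]
  · exact (extChartAt (IB.prod 𝓘(ℝ, F)) p).right_inv hy
  · have := (extChartAt (IB.prod 𝓘(ℝ, F)) p).map_target hy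
    rw [FiberBundle.extChartAt] at this ⊢
    exact this.1

/-- The chart at `p` consists of the base chart at `p.proj` and the fibre coordinate there, so in
preferred charts the projection is literally `Prod.fst`. -/
lemma hasMFDerivAt_totalSpace_proj (p : TotalSpace F E) :
    HasMFDerivAt (IB.prod 𝓘(ℝ, F)) IB (TotalSpace.proj : TotalSpace F E → B) p
      (ContinuousLinearMap.fst ℝ EB F) := by
  refine ⟨(FiberBundle.continuous_proj F E).continuousAt, ?_⟩
  refine hasFDerivWithinAt_fst.congr_of_eventuallyEq ?_ ?_
  · filter_upwards [extChartAt_target_mem_nhdsWithin (I := IB.prod 𝓘(ℝ, F)) p] with y hy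
    exact congrArg Prod.fst (extChartAt_totalSpace_symm hy)
  · exact congrArg Prod.fst (extChartAt_totalSpace_symm (mem_extChartAt_target p))

lemma hasMFDerivAt_trivializationAt_snd (p : TotalSpace F E) :
    HasMFDerivAt (IB.prod 𝓘(ℝ, F)) 𝓘(ℝ, F)
      (fun z : TotalSpace F E => (trivializationAt F E p.proj z).2) p
      (ContinuousLinearMap.snd ℝ EB F) := by
  refine ⟨?_, ?_⟩
  · exact continuousAt_snd.comp ((trivializationAt F E p.proj).continuousAt
      (FiberBundle.mem_trivializationAt_proj_source))
  refine hasFDerivWithinAt_snd.congr_of_eventuallyEq ?_ ?_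
  · filter_upwards [extChartAt_target_mem_nhdsWithin (I := IB.prod 𝓘(ℝ, F)) p] with y hy
    exact congrArg Prod.snd (extChartAt_totalSpace_symm hy)
  · have h := extChartAt_totalSpace_symm (IB := IB) (mem_extChartAt_target p)
    have h' := congrArg Prod.snd h
    exact h'

/-- Near `f x` the preferred chart is the pair of base chart and fibre coordinate, so a map into the
total space may be differentiated componentwise. -/
lemma hasMFDerivAt_totalSpace {f : N → TotalSpace F E} {x : N}
    {f₁ : EN →L[ℝ] EB} {f₂ : EN →L[ℝ] F}
    (hf : ContinuousAt f x)
    (h₁ : HasMFDerivAt IN IB (fun y => (f y).proj) x f₁)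
    (h₂ : HasMFDerivAt IN 𝓘(ℝ, F) (fun y => (trivializationAt F E (f x).proj (f y)).2) x f₂) :
    HasMFDerivAt IN (IB.prod 𝓘(ℝ, F)) f x (f₁.prod f₂) := by
  refine ⟨hf, ?_⟩
  refine (h₁.2.prodMk h₂.2).congr_of_eventuallyEq ?_ ?_
  · have h3 : f ⁻¹' (trivializationAt F E (f x).proj).source ∈ nhds x :=
      hf.preimage_mem_nhds ((trivializationAt F E (f x).proj).open_source.mem_nhds
        FiberBundle.mem_trivializationAt_proj_source)
    have h4 := extChartAt_preimage_mem_nhdsWithin (I := IN) (s := univ) (x := x)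
      (by simpa using h3)
    simp only [preimage_univ, univ_inter] at h4
    filter_upwards [h4] with y hy
    exact extChartAt_totalSpace_apply_of_mem hy
  · simp only [writtenInExtChartAt, Function.comp, extChartAt_to_inv]
    exact extChartAt_totalSpace_apply_of_mem FiberBundle.mem_trivializationAt_proj_source

end TotalSpaceDeriv

/-! ### Tangent maps of the projections of `E*` and `E* ×_M B`. -/

section Control

variable {V : Type*} [NormedAddCommGroup V] [NormedSpace ℝ V]
  {M : Type*} [TopologicalSpace M] [ChartedSpace V M] [IsManifold 𝓘(ℝ, V) ∞ M]
  {F : Type*} [NormedAddCommGroup F] [NormedSpace ℝ F]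
  {E : M → Type*} [∀ x, AddCommGroup (E x)] [∀ x, Module ℝ (E x)]
  [∀ x, TopologicalSpace (E x)] [TopologicalSpace (TotalSpace F E)]
  [FiberBundle F E] [VectorBundle ℝ F E] [ContMDiffVectorBundle ∞ F E 𝓘(ℝ, V)]
  {U : Type*} [NormedAddCommGroup U] [NormedSpace ℝ U]
  {B : Type*} [TopologicalSpace B] [ChartedSpace U B] [IsManifold 𝓘(ℝ, U) ∞ B]
  {ϖ : C^∞⟮𝓘(ℝ, U), B; 𝓘(ℝ, V), M⟯}

/-- The tangent vectors of `E*` are pairs, the first entry being the projection to `TM`. -/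
lemma mfderiv_dual_proj (μ : DualTot F E) (w : V × (F →L[ℝ] ℝ)) :
    mfderiv (dualModel V F) 𝓘(ℝ, V) (TotalSpace.proj : DualTot F E → M) μ w = w.1 := by
  rw [(hasMFDerivAt_totalSpace_proj μ).mfderiv]; rfl

lemma mfderiv_control_proj (q : ControlTot F E ϖ) (v : U × (F →L[ℝ] ℝ)) :
    mfderiv (controlModel U F) 𝓘(ℝ, U) (TotalSpace.proj : ControlTot F E ϖ → B) q v = v.1 := by
  rw [(hasMFDerivAt_totalSpace_proj q).mfderiv]; rfl

lemma mfderiv_pr₁ (q : ControlTot F E ϖ) (v : U × (F →L[ℝ] ℝ)) :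
    mfderiv (controlModel U F) (dualModel V F) pr₁ q v =
      ((mfderiv 𝓘(ℝ, U) 𝓘(ℝ, V) ϖ q.proj v.1 : V), v.2) := by
  have h₁ : HasMFDerivAt (controlModel U F) 𝓘(ℝ, V)
      (fun z : ControlTot F E ϖ => (pr₁ z).proj) q
      ((mfderiv 𝓘(ℝ, U) 𝓘(ℝ, V) ϖ q.proj : U →L[ℝ] V).comp
        (ContinuousLinearMap.fst ℝ U (F →L[ℝ] ℝ))) :=
    ((ϖ.contMDiff.mdifferentiableAt (by simp)).hasMFDerivAt).comp q
      (hasMFDerivAt_totalSpace_proj q)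
  -- The pull-back bundle carries the pulled-back trivializations, so the fibre coordinate of `q` is
  -- also that of `pr₁ q`.
  have h₂ := hasMFDerivAt_trivializationAt_snd (IB := 𝓘(ℝ, U)) q
  have h := hasMFDerivAt_totalSpace (IB := 𝓘(ℝ, V))
    (f := pr₁) (contMDiff_pr₁.continuous.continuousAt) h₁ h₂
  rw [h.mfderiv]; rfl

lemma mfderiv_baseProj (q : ControlTot F E ϖ) (v : U × (F →L[ℝ] ℝ)) :
    mfderiv (controlModel U F) 𝓘(ℝ, V) (baseProj ϖ) q v =
      mfderiv 𝓘(ℝ, U) 𝓘(ℝ, V) ϖ q.proj v.1 := by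
  have h₁ : HasMFDerivAt (controlModel U F) 𝓘(ℝ, V)
      (baseProj ϖ) q
      ((mfderiv 𝓘(ℝ, U) 𝓘(ℝ, V) ϖ q.proj : U →L[ℝ] V).comp
        (ContinuousLinearMap.fst ℝ U (F →L[ℝ] ℝ))) :=
    ((ϖ.contMDiff.mdifferentiableAt (by simp)).hasMFDerivAt).comp q
      (hasMFDerivAt_totalSpace_proj q)
  rw [h₁.mfderiv]; rfl

end Control

/-! ### Global sections from local data, and tensoriality. -/

section Sections

open scoped Topology

variable {V : Type*} [NormedAddCommGroup V] [NormedSpace ℝ V] [FiniteDimensional ℝ V]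
  {M : Type*} [TopologicalSpace M] [T2Space M] [ChartedSpace V M] [IsManifold 𝓘(ℝ, V) ∞ M]
  {F : Type*} [NormedAddCommGroup F] [NormedSpace ℝ F]
  {E : M → Type*} [∀ x, AddCommGroup (E x)] [∀ x, Module ℝ (E x)]
  [∀ x, TopologicalSpace (E x)] [TopologicalSpace (TotalSpace F E)]
  [FiberBundle F E] [VectorBundle ℝ F E] [ContMDiffVectorBundle ∞ F E 𝓘(ℝ, V)]

/-- Bump functions exist because `M` is Hausdorff and finite-dimensional. They extend germs to
global objects without partitions of unity. -/
lemma exists_cutoff (x : M) {s : Set M} (hs : s ∈ 𝓝 x) :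
    ∃ χ : C^∞⟮𝓘(ℝ, V), M; 𝓘(ℝ, ℝ), ℝ⟯, χ =ᶠ[𝓝 x] 1 ∧ tsupport χ ⊆ s := by
  obtain ⟨f, hf, -⟩ := (SmoothBumpFunction.nhds_basis_support (I := 𝓘(ℝ, V)) hs).mem_iff.1 hs
  exact ⟨⟨f, f.contMDiff⟩, f.eventuallyEq_one, hf⟩

/-- A local section times a cut-off function, as a global section. -/
def cutoffSec (χ : C^∞⟮𝓘(ℝ, V), M; 𝓘(ℝ, ℝ), ℝ⟯) {u : Set M} (hu : IsOpen u)
    (hχ : tsupport χ ⊆ u) (s : ∀ x, E x)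
    (hs : ContMDiffOn 𝓘(ℝ, V) (𝓘(ℝ, V).prod 𝓘(ℝ, F)) ∞ (fun x => (⟨x, s x⟩ : TotalSpace F E)) u) :
    Sec V F E :=
  ⟨fun x => χ x • s x, ContMDiffOn.smul_section_of_tsupport χ.contMDiff.contMDiffOn hu hχ hs⟩

/-- A local smooth function times a cut-off function, as a global function. -/
def cutoffFun (χ : C^∞⟮𝓘(ℝ, V), M; 𝓘(ℝ, ℝ), ℝ⟯) {u : Set M} (hu : IsOpen u)
    (hχ : tsupport χ ⊆ u) (f : M → ℝ) (hf : ContMDiffOn 𝓘(ℝ, V) 𝓘(ℝ, ℝ) ∞ f u) :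
    C^∞⟮𝓘(ℝ, V), M; 𝓘(ℝ, ℝ), ℝ⟯ :=
  ⟨fun x => χ x * f x, by
    refine contMDiff_of_tsupport fun x hx => ?_
    have : x ∈ u := hχ (tsupport_mul_subset_left hx)
    exact χ.contMDiff.contMDiffAt.mul ((hf x this).contMDiffAt (hu.mem_nhds this))⟩

lemma exists_sec_eventuallyEq (x : M) {u : Set M} (hu : IsOpen u) (hx : x ∈ u) (s : ∀ x, E x)
    (hs : ContMDiffOn 𝓘(ℝ, V) (𝓘(ℝ, V).prod 𝓘(ℝ, F)) ∞ (fun x => (⟨x, s x⟩ : TotalSpace F E)) u) :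
    ∃ σ : Sec V F E, ∀ᶠ y in 𝓝 x, σ y = s y := by
  obtain ⟨χ, hχ, hsupp⟩ := exists_cutoff (V := V) x (hu.mem_nhds hx)
  refine ⟨cutoffSec χ hu hsupp s hs, hχ.mono fun y hy => ?_⟩
  change χ y • s y = s y
  rw [hy]; exact one_smul ℝ _

/-- Cut off the local section with constant coordinates. The morphism condition and the formula for
`Ω` are expressed through global sections, so each fibre vector must be the value of one. -/
lemma exists_sec_apply_eq (x : M) (b : E x) : ∃ σ : Sec V F E, σ x = b := by
  let e := trivializationAt F E x
  have hx : x ∈ e.baseSet := FiberBundle.mem_baseSet_trivializationAt F E x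
  have hs : ContMDiffOn 𝓘(ℝ, V) (𝓘(ℝ, V).prod 𝓘(ℝ, F)) ∞
      (fun y => (⟨y, e.symm y (e ⟨x, b⟩).2⟩ : TotalSpace F E)) e.baseSet := by
    refine (e.contMDiffOn_section_baseSet_iff).2 ?_
    refine (contMDiffOn_const (c := (e ⟨x, b⟩).2)).congr fun y hy => ?_
    rw [e.apply_mk_symm hy]
  obtain ⟨σ, hσ⟩ := exists_sec_eventuallyEq x e.open_baseSet hx _ hs
  refine ⟨σ, hσ.self_of_nhds.trans ?_⟩
  exact e.symm_apply_apply_mk hx b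

variable [FiniteDimensional ℝ F]

/-- A tensorial functional on the sections depends on the value of the section only. -/
lemma eq_zero_of_tensorial (T : Sec V F E →ₗ[ℝ] ℝ) (x : M)
    (hT : ∀ (f : C^∞⟮𝓘(ℝ, V), M; 𝓘(ℝ, ℝ), ℝ⟯) (η : Sec V F E), T (smulSec f η) = f x * T η)
    (η : Sec V F E) (hη : η x = 0) : T η = 0 := by
  let e := trivializationAt F E x
  let b := Module.finBasis ℝ F
  have hx : x ∈ e.baseSet := FiberBundle.mem_baseSet_trivializationAt F E x
  obtain ⟨χ, hχ, hsupp⟩ := exists_cutoff (V := V) x (e.open_baseSet.mem_nhds hx)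
  let s : Fin (Module.finrank ℝ F) → Sec V F E := fun i =>
    cutoffSec χ e.open_baseSet hsupp _ (e.contMDiffOn_localFrame_baseSet (I := 𝓘(ℝ, V)) ∞ b i)
  let c : Fin (Module.finrank ℝ F) → C^∞⟮𝓘(ℝ, V), M; 𝓘(ℝ, ℝ), ℝ⟯ := fun i =>
    cutoffFun χ e.open_baseSet hsupp _
      (contMDiffOn_localFrameCoeff (I := 𝓘(ℝ, V)) (e := e) (k := ∞) b e.open_baseSet subset_rfl
        η.contMDiff.contMDiffOn i)
  -- Coefficients and frame are each cut off once, so the global combination is `χ² η`. As `χ x =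
  -- 1`, tensoriality gives `T (χ² η) = T η`.
  have key : smulSec (χ * χ) η = ∑ i, smulSec (c i) (s i) := by
    ext y
    have hsum : (∑ i, smulSec (c i) (s i)) y = ∑ i, (c i y) • s i y := by
      have := congrFun (map_sum (ContMDiffSection.coeAddHom 𝓘(ℝ, V) F ∞ E)
        (fun i => smulSec (c i) (s i)) Finset.univ) y
      refine this.trans ?_
      rw [Finset.sum_apply]; rfl
    rw [hsum]
    change (χ y * χ y) • η y = ∑ i, (χ y * e.localFrameCoeff 𝓘(ℝ, V) b i y (η y)) •
      (χ y • e.localFrame b i y)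
    by_cases hy : y ∈ e.baseSet
    · conv_lhs => rw [e.eq_sum_localFrameCoeff_smul (I := 𝓘(ℝ, V)) (b := b) (s := η) hy,
        Finset.smul_sum]
      refine Finset.sum_congr rfl fun i _ => ?_
      rw [smul_smul, smul_smul]; congr 1; ring
    · have : χ y = 0 := image_eq_zero_of_notMem_tsupport fun h => hy (hsupp h)
      simp [this]
  have h1 : T η = T (smulSec (χ * χ) η) := by
    rw [hT]
    have : χ x = 1 := hχ.self_of_nhds
    simp [this]
  rw [h1, key, map_sum]
  refine Finset.sum_eq_zero fun i _ => ?_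
  rw [hT]
  have : c i x = 0 := by
    change χ x * e.localFrameCoeff 𝓘(ℝ, V) b i x (η x) = 0
    rw [hη, map_zero, mul_zero]
  rw [this, zero_mul]

end Sections

/-! ### Fibre-linear functions on `E*` and the tensorial part of `dΘ`. -/

section FibreLinear

open scoped Topology

variable {V : Type*} [NormedAddCommGroup V] [NormedSpace ℝ V]
  {M : Type*} [TopologicalSpace M] [ChartedSpace V M] [IsManifold 𝓘(ℝ, V) ∞ M]
  {F : Type*} [NormedAddCommGroup F] [NormedSpace ℝ F]
  {E : M → Type*} [∀ x, AddCommGroup (E x)] [∀ x, Module ℝ (E x)]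
  [∀ x, TopologicalSpace (E x)] [TopologicalSpace (TotalSpace F E)]
  [FiberBundle F E] [VectorBundle ℝ F E] [ContMDiffVectorBundle ∞ F E 𝓘(ℝ, V)]
  {EN : Type*} [NormedAddCommGroup EN] [NormedSpace ℝ EN] {HN : Type*} [TopologicalSpace HN]
  {IN : ModelWithCorners ℝ EN HN} {N : Type*} [TopologicalSpace N] [ChartedSpace HN N]

/-- The pairing of a smooth map to `E*` and a smooth map to `E` over the same base map. -/
lemma contMDiff_dualPairing {n : WithTop ℕ∞} (b : N → M) (f : ∀ y, DualFib E (b y))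
    (g : ∀ y, E (b y))
    (hf : ContMDiff IN (dualModel V F) n (fun y => (⟨b y, f y⟩ : DualTot F E)))
    (hg : ContMDiff IN (𝓘(ℝ, V).prod 𝓘(ℝ, F)) n (fun y => (⟨b y, g y⟩ : TotalSpace F E))) :
    ContMDiff IN 𝓘(ℝ, ℝ) n (fun y => (f y (g y) : ℝ)) := by
  have h := ContMDiff.clm_bundle_apply (F₂ := ℝ) (E₂ := Bundle.Trivial M ℝ) (IB := 𝓘(ℝ, V)) hf hg
  intro y
  exact (contMDiffAt_totalSpace.1 (h y)).2

/-- The function on `E*` that is linear on the fibres and defined by a section of `E`. -/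
def fibreLinear (σ : Sec V F E) (μ : DualTot F E) : ℝ := μ.snd (σ μ.proj)

lemma contMDiff_fibreLinear (σ : Sec V F E) :
    ContMDiff (dualModel V F) 𝓘(ℝ, ℝ) ∞ (fibreLinear σ) :=
  contMDiff_dualPairing (V := V) (F := F) (fun μ : DualTot F E => μ.proj) (fun μ => μ.snd)
    (fun μ => σ μ.proj) contMDiff_id (σ.contMDiff.comp (contMDiff_proj (DualFib E)))

lemma mdifferentiableAt_fibreLinear (σ : Sec V F E) (μ : DualTot F E) :
    MDifferentiableAt (dualModel V F) 𝓘(ℝ, ℝ) (fibreLinear σ) μ :=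
  (contMDiff_fibreLinear σ).mdifferentiableAt (by simp)

variable (A : LieAlgebroid V F E)

/-- For a vector `w` tangent to `E*` at `μ`, the functional `η ↦ w⟨·, η⟩ - ⟨μ, [σ, η]⟩`. -/
def liouvilleFunctional (μ : DualTot F E) (w : TangentSpace (dualModel V F) μ)
    (σ : Sec V F E) : Sec V F E →ₗ[ℝ] ℝ where
  toFun η := dirDeriv (dualModel V F) (fibreLinear η) μ w - μ.snd (A.bracket σ η μ.proj)
  map_add' η ζ := by
    have h : fibreLinear (η + ζ) = fibreLinear η + fibreLinear ζ := by
      ext ν; exact ν.snd.map_add _ _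
    have h' : dirDeriv (dualModel V F) (fibreLinear (η + ζ)) μ w =
        dirDeriv (dualModel V F) (fibreLinear η) μ w +
          dirDeriv (dualModel V F) (fibreLinear ζ) μ w := by
      rw [h]
      have := mfderiv_add (mdifferentiableAt_fibreLinear η μ) (mdifferentiableAt_fibreLinear ζ μ)
      exact congrArg (fun L : TangentSpace (dualModel V F) μ →L[ℝ] ℝ => L w) this
    have h'' : μ.snd (A.bracket σ (η + ζ) μ.proj) =
        μ.snd (A.bracket σ η μ.proj) + μ.snd (A.bracket σ ζ μ.proj) := by
      rw [map_add]; exact μ.snd.map_add _ _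
    rw [h', h'']
    exact add_sub_add_comm (_ : ℝ) _ _ _
  map_smul' c η := by
    have h : fibreLinear (c • η) = c • fibreLinear η := by
      ext ν; exact ν.snd.map_smul _ _
    have h' : dirDeriv (dualModel V F) (fibreLinear (c • η)) μ w =
        c * dirDeriv (dualModel V F) (fibreLinear η) μ w := by
      rw [h]
      have := const_smul_mfderiv (mdifferentiableAt_fibreLinear η μ) c
      exact congrArg (fun L : TangentSpace (dualModel V F) μ →L[ℝ] ℝ => L w) this
    have h'' : μ.snd (A.bracket σ (c • η) μ.proj) = c * (μ.snd (A.bracket σ η μ.proj) : ℝ) := by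
      rw [map_smul]; exact μ.snd.map_smul _ _
    rw [h', h'']
    exact (mul_sub (c : ℝ) _ _).symm

lemma dirDeriv_fibreLinear_smulSec (f : C^∞⟮𝓘(ℝ, V), M; 𝓘(ℝ, ℝ), ℝ⟯) (η : Sec V F E)
    (μ : DualTot F E) (w : V × (F →L[ℝ] ℝ)) :
    dirDeriv (dualModel V F) (fibreLinear (smulSec f η)) μ w =
      f μ.proj * dirDeriv (dualModel V F) (fibreLinear η) μ w +
        fibreLinear η μ * dirDeriv 𝓘(ℝ, V) f μ.proj (w.1 : V) := by
  have h : fibreLinear (smulSec f η) =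
      (fun ν : DualTot F E => f ν.proj) * fibreLinear η := by
    ext ν; exact ν.snd.map_smul _ _
  have h₁ : HasMFDerivAt (dualModel V F) 𝓘(ℝ, ℝ) (fun ν : DualTot F E => f ν.proj) μ
      ((mfderiv 𝓘(ℝ, V) 𝓘(ℝ, ℝ) f μ.proj : V →L[ℝ] ℝ).comp
        (ContinuousLinearMap.fst ℝ V (F →L[ℝ] ℝ))) :=
    HasMFDerivAt.comp μ (f.contMDiff.mdifferentiableAt (by simp)).hasMFDerivAt
      (hasMFDerivAt_totalSpace_proj μ)
  have h₂ := (mdifferentiableAt_fibreLinear η μ).hasMFDerivAt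
  have h₃ := h₁.mul h₂
  unfold dirDeriv
  rw [h, h₃.mfderiv]
  rfl

/-- The functional is tensorial if `w` lies over the anchor of the section. -/
lemma liouvilleFunctional_smulSec (μ : DualTot F E) (w : V × (F →L[ℝ] ℝ)) (σ : Sec V F E)
    (hw : A.anchor μ.proj (σ μ.proj) = (w.1 : V)) (f : C^∞⟮𝓘(ℝ, V), M; 𝓘(ℝ, ℝ), ℝ⟯)
    (η : Sec V F E) :
    liouvilleFunctional A μ w σ (smulSec f η) = f μ.proj * liouvilleFunctional A μ w σ η := by
  change dirDeriv (dualModel V F) (fibreLinear (smulSec f η)) μ w -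
    μ.snd (A.bracket σ (smulSec f η) μ.proj) = f μ.proj *
    (dirDeriv (dualModel V F) (fibreLinear η) μ w - μ.snd (A.bracket σ η μ.proj) : ℝ)
  have h : μ.snd (A.bracket σ (smulSec f η) μ.proj) =
      dirDeriv 𝓘(ℝ, V) f μ.proj (A.anchor μ.proj (σ μ.proj)) * fibreLinear η μ +
        f μ.proj * (μ.snd (A.bracket σ η μ.proj) : ℝ) := by
    rw [A.leibniz, map_add, map_smul, map_smul]; rfl
  -- The product rule contributes `w(f) ⟨μ, η⟩` and the bracket contributes `ρ(σ)(f) ⟨μ, η⟩`; these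
  -- cancel because `w` lies over `ρ(σ)`.
  rw [dirDeriv_fibreLinear_smulSec, h, hw]
  ring

end FibreLinear

/-! ### Extending elements of `𝒯ᴱE*` to projectable sections. -/

section Extension

open scoped Topology

variable {V : Type*} [NormedAddCommGroup V] [NormedSpace ℝ V]
  {M : Type*} [TopologicalSpace M] [ChartedSpace V M] [IsManifold 𝓘(ℝ, V) ∞ M]
  {F : Type*} [NormedAddCommGroup F] [NormedSpace ℝ F]
  {E : M → Type*} [∀ x, AddCommGroup (E x)] [∀ x, Module ℝ (E x)]
  [∀ x, TopologicalSpace (E x)] [TopologicalSpace (TotalSpace F E)]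
  [FiberBundle F E] [VectorBundle ℝ F E] [ContMDiffVectorBundle ∞ F E 𝓘(ℝ, V)]

/-- The vector field on `M` defined by a section of `E`. -/
def anchorField (A : LieAlgebroid V F E) (σ : Sec V F E) :
    ContMDiffSection 𝓘(ℝ, V) V ∞ (fun x : M => TangentSpace 𝓘(ℝ, V) x) :=
  ⟨fun x => A.anchor x (σ x), A.smooth_anchor.comp σ.contMDiff⟩

/-- The two trivializations of the tangent bundles of `E*` and `M` are compatible with the
projection. -/
lemma tangent_trivialization_dual_proj (μ ν : DualTot F E)
    (hν : ν ∈ (chartAt (ModelProd V (F →L[ℝ] ℝ)) μ).source)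
    (w : TangentSpace (dualModel V F) ν) :
    (trivializationAt V (TangentSpace 𝓘(ℝ, V)) μ.proj
      ⟨ν.proj, mfderiv (dualModel V F) 𝓘(ℝ, V) (TotalSpace.proj : DualTot F E → M) ν w⟩).2 =
    (trivializationAt (V × (F →L[ℝ] ℝ)) (TangentSpace (dualModel V F)) μ ⟨ν, w⟩).2.1 := by
  have hν' : ν ∈ (extChartAt (dualModel V F) μ).source := by rwa [extChartAt_source]
  have hν'' := hν'
  rw [FiberBundle.extChartAt] at hν''
  have hs : ν ∈ (trivializationAt (F →L[ℝ] ℝ) (DualFib E) μ.proj).source := hν''.1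
  have hM : ν.proj ∈ (chartAt V μ.proj).source := by
    have h := hν''.2.1
    rw [← extChartAt_source 𝓘(ℝ, V)]
    have h2 : (trivializationAt (F →L[ℝ] ℝ) (DualFib E) μ.proj ν).1 = ν.proj :=
      Trivialization.coe_fst _ hs
    rw [← h2]; exact h
  -- Trivializations of tangent bundles are derivatives of the preferred charts. Both sides thus
  -- become derivatives at `ν` of two functions that agree near `ν`: the base chart after the
  -- projection, and the base component of the chart of `E*`.
  have e₁ := TangentBundle.continuousLinearMapAt_trivializationAt (I := 𝓘(ℝ, V)) hM
  have e₂ := TangentBundle.continuousLinearMapAt_trivializationAt (I := dualModel V F) hν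
  rw [← Trivialization.continuousLinearMapAt_apply_of_mem (R := ℝ)
    (trivializationAt V (TangentSpace 𝓘(ℝ, V)) μ.proj) hM,
    ← Trivialization.continuousLinearMapAt_apply_of_mem (R := ℝ)
    (trivializationAt (V × (F →L[ℝ] ℝ)) (TangentSpace (dualModel V F)) μ) hν, e₁, e₂]
  have d₁ : HasMFDerivAt (dualModel V F) 𝓘(ℝ, V)
      (fun ν' : DualTot F E => extChartAt 𝓘(ℝ, V) μ.proj ν'.proj) ν
      ((mfderiv 𝓘(ℝ, V) 𝓘(ℝ, V) (extChartAt 𝓘(ℝ, V) μ.proj) ν.proj).comp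
        (mfderiv (dualModel V F) 𝓘(ℝ, V) (TotalSpace.proj : DualTot F E → M) ν)) :=
    HasMFDerivAt.comp ν (mdifferentiableAt_extChartAt hM).hasMFDerivAt
      ((contMDiff_proj (n := ∞) (DualFib E)).mdifferentiableAt (by simp)).hasMFDerivAt
  have d₂ : HasMFDerivAt (dualModel V F) 𝓘(ℝ, V)
      (fun ν' : DualTot F E => (extChartAt (dualModel V F) μ ν').1) ν
      ((ContinuousLinearMap.fst ℝ V (F →L[ℝ] ℝ)).comp
        (mfderiv (dualModel V F) 𝓘(ℝ, V × (F →L[ℝ] ℝ)) (extChartAt (dualModel V F) μ) ν)) :=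
    HasMFDerivAt.comp (I' := 𝓘(ℝ, V × (F →L[ℝ] ℝ))) ν
      (ContinuousLinearMap.fst ℝ V (F →L[ℝ] ℝ)).hasMFDerivAt
      (mdifferentiableAt_extChartAt hν).hasMFDerivAt
  have hEq : (fun ν' : DualTot F E => (extChartAt (dualModel V F) μ ν').1) =ᶠ[𝓝 ν]
      (fun ν' : DualTot F E => extChartAt 𝓘(ℝ, V) μ.proj ν'.proj) := by
    filter_upwards [(trivializationAt (F →L[ℝ] ℝ) (DualFib E) μ.proj).open_source.mem_nhds hs]
      with ν' hν'
    rw [extChartAt_totalSpace_apply_of_mem hν']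
  have := hasMFDerivAt_unique d₁ (d₂.congr_of_eventuallyEq hEq.symm)
  exact congrArg (fun L : TangentSpace (dualModel V F) ν →L[ℝ] V => L w) this

variable [FiniteDimensional ℝ V] [T2Space M]

/-- Every element of the prolongation `𝒯ᴱE*` extends to a projectable section. -/
lemma exists_projectableSection (A : LieAlgebroid V F E) (μ : DualTot F E)
    (z : prol (dualModel V F) A (TotalSpace.proj : DualTot F E → M) μ) :
    ∃ Z : ProjectableSection (dualModel V F) A (TotalSpace.proj : DualTot F E → M),
      Z.val μ = z := by
  obtain ⟨σ, hσ⟩ := exists_sec_apply_eq (V := V) (F := F) μ.proj z.1.1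
  let eT := trivializationAt (V × (F →L[ℝ] ℝ)) (TangentSpace (dualModel V F)) μ
  let eM := trivializationAt V (TangentSpace 𝓘(ℝ, V)) μ.proj
  let eE := trivializationAt (F →L[ℝ] ℝ) (DualFib E) μ.proj
  -- The chart domain is the full preimage of an open subset of `M`, so a cut-off function on `M`
  -- suffices. Multiplying base section and field by the same function of `ν.proj` keeps the pair
  -- projectable.
  have hbase : (chartAt (ModelProd V (F →L[ℝ] ℝ)) μ).source =
      TotalSpace.proj ⁻¹' (eE.baseSet ∩ (chartAt V μ.proj).source) := by
    rw [FiberBundle.chartedSpace_chartAt]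
    ext ν
    change ν ∈ eE.source ∧ (eE ν).1 ∈ (chartAt V μ.proj).source ∧ True ↔
      ν.proj ∈ eE.baseSet ∧ ν.proj ∈ (chartAt V μ.proj).source
    rw [eE.mem_source, and_true]
    refine and_congr_right fun h => ?_
    rw [eE.coe_fst' h]
  obtain ⟨χ, hχ, hsupp⟩ := exists_cutoff (V := V) μ.proj
    (s := eE.baseSet ∩ (chartAt V μ.proj).source)
    ((eE.open_baseSet.inter (chartAt V μ.proj).open_source).mem_nhds
      ⟨FiberBundle.mem_baseSet_trivializationAt _ _ _, mem_chart_source V μ.proj⟩)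
  -- Coordinates of the field to be built: projectability forces the base part to be that of `ρ(σ)`;
  -- the fibre part is kept constant, equal to that of `z`.
  let g : DualTot F E → V × (F →L[ℝ] ℝ) := fun ν =>
    ((eM ⟨ν.proj, anchorField A σ ν.proj⟩).2, (eT ⟨μ, z.1.2⟩).2.2)
  have hg : ContMDiffOn (dualModel V F) 𝓘(ℝ, V × (F →L[ℝ] ℝ)) ∞ g eT.baseSet := by
    refine ContMDiffOn.prodMk_space ?_ contMDiffOn_const
    have h := (eM.contMDiffOn_section_baseSet_iff (s := anchorField A σ)).1
      (anchorField A σ).contMDiff.contMDiffOn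
    refine h.comp (contMDiff_proj (DualFib E)).contMDiffOn fun ν hν => ?_
    have : ν ∈ (chartAt (ModelProd V (F →L[ℝ] ℝ)) μ).source := hν
    rw [hbase] at this
    exact this.2
  have hs : ContMDiffOn (dualModel V F) ((dualModel V F).prod 𝓘(ℝ, V × (F →L[ℝ] ℝ))) ∞
      (fun ν => (⟨ν, eT.symm ν (g ν)⟩ : TangentBundle (dualModel V F) (DualTot F E)))
      eT.baseSet := by
    refine (eT.contMDiffOn_section_baseSet_iff (s := fun ν => eT.symm ν (g ν))).2 ?_
    exact hg.congr fun ν hν => by rw [eT.apply_mk_symm hν]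
  have hχ' : ContMDiff (dualModel V F) 𝓘(ℝ, ℝ) ∞ (fun ν : DualTot F E => χ ν.proj) :=
    χ.contMDiff.comp (contMDiff_proj (DualFib E))
  have hsupp' : tsupport (fun ν : DualTot F E => χ ν.proj) ⊆ eT.baseSet := by
    refine (tsupport_comp_subset_preimage χ (FiberBundle.continuous_proj _ (DualFib E))).trans ?_
    change _ ⊆ (chartAt (ModelProd V (F →L[ℝ] ℝ)) μ).source
    rw [hbase]
    exact preimage_mono hsupp
  have hfield := ContMDiffOn.smul_section_of_tsupport hχ'.contMDiffOn eT.open_baseSet hsupp' hs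
  refine ⟨⟨smulSec χ σ, ⟨_, hfield⟩, fun ν => ?_⟩, ?_⟩
  · change A.anchor ν.proj (χ ν.proj • σ ν.proj) =
      mfderiv (dualModel V F) 𝓘(ℝ, V) (TotalSpace.proj : DualTot F E → M) ν
        (χ ν.proj • eT.symm ν (g ν))
    have hlin := ((mfderiv (dualModel V F) 𝓘(ℝ, V) (TotalSpace.proj : DualTot F E → M) ν :
      V × (F →L[ℝ] ℝ) →L[ℝ] V)).map_smul (χ ν.proj) (eT.symm ν (g ν))
    refine ((A.anchor ν.proj).map_smul (χ ν.proj) (σ ν.proj)).trans (Eq.trans ?_ hlin.symm)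
    by_cases hν : ν ∈ eT.baseSet
    · congr 1
      have hν' : ν ∈ (chartAt (ModelProd V (F →L[ℝ] ℝ)) μ).source := hν
      have h1 := tangent_trivialization_dual_proj μ ν hν' (eT.symm ν (g ν))
      have h2 : (eT ⟨ν, eT.symm ν (g ν)⟩).2 = g ν := by rw [eT.apply_mk_symm hν]
      have h3 := h1.trans (congrArg Prod.fst h2)
      rw [hbase] at hν'
      have h4 : ν.proj ∈ eM.baseSet := hν'.2
      refine ((eM.continuousLinearEquivAt ℝ ν.proj h4).injective ?_).symm
      exact h3
    · have : χ ν.proj = 0 :=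
        image_eq_zero_of_notMem_tsupport (f := fun ν : DualTot F E => χ ν.proj)
          fun h => hν (hsupp' h)
      rw [this, zero_smul, zero_smul]
  · have hχ1 : χ μ.proj = 1 := hχ.self_of_nhds
    have hμ : μ ∈ eT.baseSet := FiberBundle.mem_baseSet_trivializationAt _ _ _
    have hgμ : g μ = (eT ⟨μ, z.1.2⟩).2 := by
      refine Prod.ext ?_ rfl
      have h1 := tangent_trivialization_dual_proj μ μ hμ z.1.2
      refine Eq.trans ?_ h1
      have hz : A.anchor μ.proj z.1.1 = _ := z.2
      rw [← hz, ← hσ]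
      rfl
    refine Subtype.ext (Prod.ext ?_ ?_)
    · change χ μ.proj • σ μ.proj = z.1.1
      rw [hχ1, one_smul, hσ]
    · change χ μ.proj • eT.symm μ (g μ) = z.1.2
      rw [hχ1, one_smul, hgμ]
      exact eT.symm_apply_apply_mk hμ z.1.2

end Extension

/-! ### The canonical symplectic section: formula and nondegeneracy. -/

section CanonicalForm

open scoped Topology

variable {V : Type*} [NormedAddCommGroup V] [NormedSpace ℝ V]
  {M : Type*} [TopologicalSpace M] [ChartedSpace V M] [IsManifold 𝓘(ℝ, V) ∞ M]
  {F : Type*} [NormedAddCommGroup F] [NormedSpace ℝ F]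
  {E : M → Type*} [∀ x, AddCommGroup (E x)] [∀ x, Module ℝ (E x)]
  [∀ x, TopologicalSpace (E x)] [TopologicalSpace (TotalSpace F E)]
  [FiberBundle F E] [VectorBundle ℝ F E] [ContMDiffVectorBundle ∞ F E 𝓘(ℝ, V)]
  (A : LieAlgebroid V F E)

/-- The linear form on the fibre of `E` with given coordinates in the preferred trivialization
of `E*`. -/
def dualOfCoord (F : Type*) [NormedAddCommGroup F] [NormedSpace ℝ F]
    [TopologicalSpace (TotalSpace F E)] [FiberBundle F E] [VectorBundle ℝ F E] (x : M) :
    (F →L[ℝ] ℝ) ≃ₗ[ℝ] DualFib E x :=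
  ((trivializationAt (F →L[ℝ] ℝ) (DualFib E) x).linearEquivAt ℝ x
    (FiberBundle.mem_baseSet_trivializationAt _ _ _)).symm

/-- The derivative of a fibre-linear function in a vertical direction. -/
lemma dirDeriv_fibreLinear_vertical (σ : Sec V F E) (μ : DualTot F E) (β : F →L[ℝ] ℝ) :
    dirDeriv (dualModel V F) (fibreLinear σ) μ ((0, β) : V × (F →L[ℝ] ℝ)) =
      (dualOfCoord F μ.proj β (σ μ.proj) : ℝ) := by
  let e := trivializationAt (F →L[ℝ] ℝ) (DualFib E) μ.proj
  have hx : μ.proj ∈ e.baseSet := FiberBundle.mem_baseSet_trivializationAt _ _ _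
  -- `c` parametrises the fibre of `E*` through `μ = c ξ₀`. Along the line `ξ₀ + tβ` the
  -- fibre-linear function is affine in `t`, so its derivative can be read off.
  let c : (F →L[ℝ] ℝ) → DualTot F E := fun ξ => ⟨μ.proj, dualOfCoord F μ.proj ξ⟩
  let ξ₀ : F →L[ℝ] ℝ := (dualOfCoord F μ.proj).symm μ.snd
  have hc₀ : c ξ₀ = μ := by
    simp only [c, ξ₀, LinearEquiv.apply_symm_apply]
  have hcs : ∀ ξ, (e (c ξ)).2 = ξ := fun ξ => by
    exact (e.linearEquivAt ℝ μ.proj hx).apply_symm_apply ξ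
  have hcont : ContMDiff 𝓘(ℝ, F →L[ℝ] ℝ) (dualModel V F) ∞ c := by
    intro ξ
    rw [contMDiffAt_totalSpace]
    exact ⟨contMDiffAt_const, contMDiffAt_id.congr_of_eventuallyEq (.of_forall hcs)⟩
  have hc : HasMFDerivAt 𝓘(ℝ, F →L[ℝ] ℝ) (dualModel V F) c ξ₀
      ((0 : (F →L[ℝ] ℝ) →L[ℝ] V).prod (ContinuousLinearMap.id ℝ (F →L[ℝ] ℝ))) := by
    refine hasMFDerivAt_totalSpace hcont.continuous.continuousAt
      (hasMFDerivAt_const _ _) ?_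
    refine (hasMFDerivAt_id ξ₀).congr_of_eventuallyEq (.of_forall hcs)
  have hf : HasMFDerivAt (dualModel V F) 𝓘(ℝ, ℝ) (fibreLinear σ) (c ξ₀)
      (mfderiv (dualModel V F) 𝓘(ℝ, ℝ) (fibreLinear σ) μ) := by
    rw [hc₀]; exact (mdifferentiableAt_fibreLinear σ μ).hasMFDerivAt
  have h₁ := hf.comp ξ₀ hc
  have hd := hasMFDerivAt_iff_hasFDerivAt.1 h₁
  have hline := (hd.comp_hasDerivAt_of_eq (0 : ℝ)
    (((hasDerivAt_id (0 : ℝ)).smul_const β).const_add ξ₀) (by simp))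
  have hline' : HasDerivAt (fun t : ℝ => (μ.snd (σ μ.proj) : ℝ) +
      t * (dualOfCoord F μ.proj β (σ μ.proj) : ℝ)) (dualOfCoord F μ.proj β (σ μ.proj) : ℝ) 0 := by
    simpa using ((hasDerivAt_id (0 : ℝ)).mul_const
      (dualOfCoord F μ.proj β (σ μ.proj) : ℝ)).const_add (μ.snd (σ μ.proj) : ℝ)
  have heq : ((fibreLinear σ ∘ c) ∘ fun t : ℝ => ξ₀ + id t • β) =
      fun t : ℝ => (μ.snd (σ μ.proj) : ℝ) + t * (dualOfCoord F μ.proj β (σ μ.proj) : ℝ) := by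
    ext t
    change (dualOfCoord F μ.proj (ξ₀ + t • β)) (σ μ.proj) = _
    rw [map_add, map_smul, LinearEquiv.apply_symm_apply]
    rfl
  rw [heq] at hline
  have := hline.unique hline'
  rw [← this]
  simp only [one_smul]
  rfl

lemma bracket_skew (σ η : Sec V F E) : A.bracket σ η = - A.bracket η σ := by
  have h := A.bracket_self (σ + η)
  rw [map_add, LinearMap.map_add₂, LinearMap.map_add₂, A.bracket_self, A.bracket_self,
    zero_add, add_zero] at h
  exact eq_neg_of_add_eq_zero_right h

/-- This is skewness of `w₂⟨·, σ₁⟩ - w₁⟨·, σ₂⟩ + ⟨μ, [σ₁, σ₂]⟩`. It transfers tensoriality from the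
second slot to the first. -/
lemma liouvilleFunctional_sub_swap (μ : DualTot F E) (w₁ w₂ : TangentSpace (dualModel V F) μ)
    (σ₁ σ₂ : Sec V F E) :
    dirDeriv (dualModel V F) (fibreLinear σ₁) μ w₂ - liouvilleFunctional A μ w₁ σ₁ σ₂ =
      - (dirDeriv (dualModel V F) (fibreLinear σ₂) μ w₁ - liouvilleFunctional A μ w₂ σ₂ σ₁) := by
  change (dirDeriv (dualModel V F) (fibreLinear σ₁) μ w₂ : ℝ) -
    (dirDeriv (dualModel V F) (fibreLinear σ₂) μ w₁ - μ.snd (A.bracket σ₁ σ₂ μ.proj) : ℝ) =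
    -((dirDeriv (dualModel V F) (fibreLinear σ₂) μ w₁ : ℝ) -
    (dirDeriv (dualModel V F) (fibreLinear σ₁) μ w₂ - μ.snd (A.bracket σ₂ σ₁ μ.proj) : ℝ))
  have h : μ.snd (A.bracket σ₁ σ₂ μ.proj) = - (μ.snd (A.bracket σ₂ σ₁ μ.proj) : ℝ) := by
    rw [bracket_skew]; exact μ.snd.map_neg _
  rw [h]; ring

variable [FiniteDimensional ℝ V] [T2Space M] [FiniteDimensional ℝ F]

/-- Membership of `z` in the prolongation is exactly the condition under which the functional is
tensorial. -/
lemma liouvilleFunctional_congr (μ : DualTot F E)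
    (z : prol (dualModel V F) A (TotalSpace.proj : DualTot F E → M) μ)
    (σ η η' : Sec V F E) (hσ : σ μ.proj = z.1.1) (hη : η μ.proj = η' μ.proj) :
    liouvilleFunctional A μ z.1.2 σ η = liouvilleFunctional A μ z.1.2 σ η' := by
  rw [← sub_eq_zero, ← map_sub]
  refine eq_zero_of_tensorial _ μ.proj (fun f ζ => ?_) _ ?_
  · refine liouvilleFunctional_smulSec A μ z.1.2 σ ?_ f ζ
    rw [hσ]
    exact (show A.anchor μ.proj z.1.1 = _ from z.2).trans (mfderiv_dual_proj μ z.1.2)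
  · change η μ.proj - η' μ.proj = 0
    rw [hη, sub_self]

/-- The canonical symplectic section, computed with any sections of `E` through the base
components of its arguments. -/
lemma canonicalForm_eq (μ : DualTot F E)
    (z₁ z₂ : prol (dualModel V F) A (TotalSpace.proj : DualTot F E → M) μ)
    (σ₁ σ₂ : Sec V F E) (h₁ : σ₁ μ.proj = z₁.1.1) (h₂ : σ₂ μ.proj = z₂.1.1) :
    canonicalForm A μ z₁ z₂ =
      dirDeriv (dualModel V F) (fibreLinear σ₁) μ z₂.1.2 -
        liouvilleFunctional A μ z₁.1.2 σ₁ σ₂ := by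
  -- `prolExtDAt` chooses its extensions; their existence is what guarantees that the chosen ones
  -- take the values `z₁`, `z₂` at `μ`.
  have hZ₁ := Classical.epsilon_spec (exists_projectableSection A μ z₁)
  have hZ₂ := Classical.epsilon_spec (exists_projectableSection A μ z₂)
  unfold canonicalForm prolExtDAt
  set Z₁ := Classical.epsilon (fun Z : ProjectableSection (dualModel V F) A
    (TotalSpace.proj : DualTot F E → M) => Z.val μ = z₁) with hdef₁
  set Z₂ := Classical.epsilon (fun Z : ProjectableSection (dualModel V F) A
    (TotalSpace.proj : DualTot F E → M) => Z.val μ = z₂) with hdef₂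
  have hb₁ : Z₁.base μ.proj = z₁.1.1 := congrArg (fun z => z.1.1) hZ₁
  have hb₂ : Z₂.base μ.proj = z₂.1.1 := congrArg (fun z => z.1.1) hZ₂
  have hf₁ : Z₁.field μ = z₁.1.2 := congrArg (fun z => z.1.2) hZ₁
  have hf₂ : Z₂.field μ = z₂.1.2 := congrArg (fun z => z.1.2) hZ₂
  have step : - prolExtD (dualModel V F) liouville Z₁ Z₂ μ =
      dirDeriv (dualModel V F) (fibreLinear Z₁.base) μ z₂.1.2 -
        liouvilleFunctional A μ z₁.1.2 Z₁.base Z₂.base := by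
    change -(dirDeriv (dualModel V F) (fibreLinear Z₂.base) μ (Z₁.field μ) -
      dirDeriv (dualModel V F) (fibreLinear Z₁.base) μ (Z₂.field μ) -
      μ.snd (A.bracket Z₁.base Z₂.base μ.proj) : ℝ) =
      (dirDeriv (dualModel V F) (fibreLinear Z₁.base) μ z₂.1.2 : ℝ) -
      (dirDeriv (dualModel V F) (fibreLinear Z₂.base) μ z₁.1.2 -
        μ.snd (A.bracket Z₁.base Z₂.base μ.proj) : ℝ)
    rw [hf₁, hf₂]; ring
  -- Tensoriality replaces the second chosen section; after a swap it replaces the first, and a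
  -- second swap restores the order.
  rw [step, liouvilleFunctional_congr A μ z₁ _ _ σ₂ hb₁ (hb₂.trans h₂.symm),
    liouvilleFunctional_sub_swap, liouvilleFunctional_congr A μ z₂ _ _ σ₁ h₂ (hb₁.trans h₁.symm),
    ← liouvilleFunctional_sub_swap]

/-- The canonical symplectic section at a point, as a bilinear form. -/
def canonicalBilin (μ : DualTot F E) :
    prol (dualModel V F) A (TotalSpace.proj : DualTot F E → M) μ →ₗ[ℝ]
      prol (dualModel V F) A (TotalSpace.proj : DualTot F E → M) μ →ₗ[ℝ] ℝ := by
  -- The chosen extensions need not be additive. Freedom of choice in `canonicalForm_eq` allows `σ₂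
  -- + σ₃` as the section through the base component of `z₂ + z₃`.
  have radd : ∀ z₁ z₂ z₃, canonicalForm A μ z₁ (z₂ + z₃) =
      canonicalForm A μ z₁ z₂ + canonicalForm A μ z₁ z₃ := fun z₁ z₂ z₃ => by
    obtain ⟨σ₁, h₁⟩ := exists_sec_apply_eq (V := V) (F := F) μ.proj z₁.1.1
    obtain ⟨σ₂, h₂⟩ := exists_sec_apply_eq (V := V) (F := F) μ.proj z₂.1.1
    obtain ⟨σ₃, h₃⟩ := exists_sec_apply_eq (V := V) (F := F) μ.proj z₃.1.1
    rw [canonicalForm_eq A μ z₁ z₂ σ₁ σ₂ h₁ h₂, canonicalForm_eq A μ z₁ z₃ σ₁ σ₃ h₁ h₃,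
      canonicalForm_eq A μ z₁ (z₂ + z₃) σ₁ (σ₂ + σ₃) h₁ (by
        change σ₂ μ.proj + σ₃ μ.proj = z₂.1.1 + z₃.1.1
        rw [h₂, h₃]), map_add]
    have : dirDeriv (dualModel V F) (fibreLinear σ₁) μ (z₂.1.2 + z₃.1.2) =
      dirDeriv (dualModel V F) (fibreLinear σ₁) μ z₂.1.2 +
      dirDeriv (dualModel V F) (fibreLinear σ₁) μ z₃.1.2 :=
        ContinuousLinearMap.map_add (mfderiv (dualModel V F) 𝓘(ℝ, ℝ) (fibreLinear σ₁) μ) _ _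
    exact (congrArg (· - _) this).trans (add_sub_add_comm _ _ _ _)
  have rsmul : ∀ (c : ℝ) z₁ z₂, canonicalForm A μ z₁ (c • z₂) =
      c * canonicalForm A μ z₁ z₂ := fun c z₁ z₂ => by
    obtain ⟨σ₁, h₁⟩ := exists_sec_apply_eq (V := V) (F := F) μ.proj z₁.1.1
    obtain ⟨σ₂, h₂⟩ := exists_sec_apply_eq (V := V) (F := F) μ.proj z₂.1.1
    rw [canonicalForm_eq A μ z₁ z₂ σ₁ σ₂ h₁ h₂,
      canonicalForm_eq A μ z₁ (c • z₂) σ₁ (c • σ₂) h₁ (by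
        change c • σ₂ μ.proj = c • z₂.1.1
        rw [h₂]), map_smul]
    have : dirDeriv (dualModel V F) (fibreLinear σ₁) μ (c • z₂.1.2) =
      c * dirDeriv (dualModel V F) (fibreLinear σ₁) μ z₂.1.2 :=
        ContinuousLinearMap.map_smul (mfderiv (dualModel V F) 𝓘(ℝ, ℝ) (fibreLinear σ₁) μ) _ _
    exact (congrArg (· - _) this).trans (mul_sub c _ _).symm
  have swap : ∀ z₁ z₂, canonicalForm A μ z₁ z₂ = - canonicalForm A μ z₂ z₁ := fun z₁ z₂ => by
    obtain ⟨σ₁, h₁⟩ := exists_sec_apply_eq (V := V) (F := F) μ.proj z₁.1.1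
    obtain ⟨σ₂, h₂⟩ := exists_sec_apply_eq (V := V) (F := F) μ.proj z₂.1.1
    rw [canonicalForm_eq A μ z₁ z₂ σ₁ σ₂ h₁ h₂, canonicalForm_eq A μ z₂ z₁ σ₂ σ₁ h₂ h₁,
      liouvilleFunctional_sub_swap]
  exact LinearMap.mk₂ ℝ (canonicalForm A μ)
    (fun z₁ z₂ z₃ => by rw [swap, radd, neg_add, ← swap, ← swap])
    (fun c z₁ z₂ => by rw [swap, rsmul, ← mul_neg, ← swap]; rfl) radd rsmul

lemma canonicalBilin_apply (μ : DualTot F E)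
    (z₁ z₂ : prol (dualModel V F) A (TotalSpace.proj : DualTot F E → M) μ) :
    canonicalBilin A μ z₁ z₂ = canonicalForm A μ z₁ z₂ := rfl

/-- Let `z = (b, w)` be in the kernel. Pairing with vertical elements `(0, (0, β))` evaluates every
covector on `b`, so `b = 0`; the anchor condition then makes `w` vertical. Pairing with `(b',
(ρ(b'), 0))` evaluates the fibre part of `w` on every `b'`, so `w = 0`. -/
lemma canonicalBilin_injective (μ : DualTot F E) : Function.Injective (canonicalBilin A μ) := by
  rw [← LinearMap.ker_eq_bot, LinearMap.ker_eq_bot']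
  intro z hz
  replace hz : ∀ z', canonicalForm A μ z z' = 0 := fun z' => LinearMap.congr_fun hz z'
  obtain ⟨σ, hσ⟩ := exists_sec_apply_eq (V := V) (F := F) μ.proj z.1.1
  have hb : z.1.1 = 0 := by
    have h : ∀ ν : DualFib E μ.proj, ν z.1.1 = (0 : ℝ) := fun ν => by
      let β := (dualOfCoord F μ.proj).symm ν
      have hmem : ((0, ((0, β) : V × (F →L[ℝ] ℝ))) :
          E μ.proj × TangentSpace (dualModel V F) μ) ∈
          prol (dualModel V F) A (TotalSpace.proj : DualTot F E → M) μ := by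
        change A.anchor μ.proj 0 = _
        rw [mfderiv_dual_proj, map_zero]; rfl
      have h := hz ⟨_, hmem⟩
      rw [canonicalForm_eq A μ z ⟨_, hmem⟩ σ 0 hσ rfl, map_zero, sub_zero] at h
      have h' := (dirDeriv_fibreLinear_vertical σ μ β).symm.trans h
      rw [LinearEquiv.apply_symm_apply, hσ] at h'
      exact h'
    let e := VectorBundle.continuousLinearEquivAt ℝ F E μ.proj
    apply e.injective
    rw [map_zero]
    by_contra hne
    obtain ⟨f, hf⟩ := SeparatingDual.exists_ne_zero (R := ℝ) hne
    exact hf (h (f.comp (e : E μ.proj →L[ℝ] F)))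
  have hw₁ : (z.1.2 : V × (F →L[ℝ] ℝ)).1 = 0 := by
    have := (mfderiv_dual_proj μ z.1.2).symm.trans
      (show A.anchor μ.proj z.1.1 = _ from z.2).symm
    rw [hb, map_zero] at this
    exact this
  have hw₂ : (z.1.2 : V × (F →L[ℝ] ℝ)).2 = 0 := by
    apply (dualOfCoord (E := E) F μ.proj).injective
    rw [map_zero]
    ext b
    have hmem : ((b, ((A.anchor μ.proj b, 0) : V × (F →L[ℝ] ℝ))) :
        E μ.proj × TangentSpace (dualModel V F) μ) ∈
        prol (dualModel V F) A (TotalSpace.proj : DualTot F E → M) μ := by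
      change A.anchor μ.proj b = _
      rw [mfderiv_dual_proj]
    obtain ⟨η, hη⟩ := exists_sec_apply_eq (V := V) (F := F) μ.proj b
    have h := hz ⟨_, hmem⟩
    -- Since the base component of `z` vanishes, the zero section runs through it, and only the
    -- derivative of `⟨·, η⟩` along `w` survives.
    rw [canonicalForm_eq A μ z ⟨_, hmem⟩ 0 η hb.symm hη] at h
    have h0 : fibreLinear (0 : Sec V F E) = fun _ => 0 := by
      ext ν; exact ν.snd.map_zero
    have h1 : dirDeriv (dualModel V F) (fibreLinear (0 : Sec V F E)) μ
        ((A.anchor μ.proj b, 0) : V × (F →L[ℝ] ℝ)) = 0 := by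
      unfold dirDeriv
      rw [h0, mfderiv_const]; rfl
    have h2 : liouvilleFunctional A μ z.1.2 0 η =
        dirDeriv (dualModel V F) (fibreLinear η) μ z.1.2 := by
      change (dirDeriv (dualModel V F) (fibreLinear η) μ z.1.2 : ℝ) -
        μ.snd (A.bracket 0 η μ.proj) = dirDeriv (dualModel V F) (fibreLinear η) μ z.1.2
      have : μ.snd (A.bracket 0 η μ.proj) = (0 : ℝ) := by
        rw [map_zero]; exact μ.snd.map_zero
      rw [this, sub_zero]
    have h3 : (z.1.2 : V × (F →L[ℝ] ℝ)) = (0, (z.1.2 : V × (F →L[ℝ] ℝ)).2) :=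
      Prod.ext hw₁ rfl
    have h4 := dirDeriv_fibreLinear_vertical η μ (z.1.2 : V × (F →L[ℝ] ℝ)).2
    rw [← h3, ← h2, hη] at h4
    rw [← h4]
    have h5 : (0 : ℝ) - liouvilleFunctional A μ z.1.2 0 η = 0 := by
      rw [← h1]; exact h.trans h1.symm
    simpa using h5
  exact Subtype.ext (Prod.ext hb (Prod.ext hw₁ hw₂))

instance (μ : DualTot F E) : FiniteDimensional ℝ
    (prol (dualModel V F) A (TotalSpace.proj : DualTot F E → M) μ) := by
  have : FiniteDimensional ℝ (E μ.proj) := VectorBundle.finiteDimensional ℝ F E μ.proj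
  have : FiniteDimensional ℝ (TangentSpace (dualModel V F) μ) :=
    inferInstanceAs (FiniteDimensional ℝ (V × (F →L[ℝ] ℝ)))
  infer_instance

lemma canonicalBilin_bijective (μ : DualTot F E) : Function.Bijective (canonicalBilin A μ) := by
  refine ⟨canonicalBilin_injective A μ, ?_⟩
  refine (LinearMap.injective_iff_surjective_of_finrank_eq_finrank ?_).1
    (canonicalBilin_injective A μ)
  exact (Subspace.dual_finrank_eq).symm

end CanonicalForm

/-! ### Unique solvability of the symplectic equation on the critical set. -/

section Symplectic

variable {V : Type*} [NormedAddCommGroup V] [NormedSpace ℝ V]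
  {M : Type*} [TopologicalSpace M] [ChartedSpace V M] [IsManifold 𝓘(ℝ, V) ∞ M]
  {F : Type*} [NormedAddCommGroup F] [NormedSpace ℝ F]
  {E : M → Type*} [∀ x, AddCommGroup (E x)] [∀ x, Module ℝ (E x)]
  [∀ x, TopologicalSpace (E x)] [TopologicalSpace (TotalSpace F E)]
  [FiberBundle F E] [VectorBundle ℝ F E] [ContMDiffVectorBundle ∞ F E 𝓘(ℝ, V)]
  {U : Type*} [NormedAddCommGroup U] [NormedSpace ℝ U]
  {B : Type*} [TopologicalSpace B] [ChartedSpace U B] [IsManifold 𝓘(ℝ, U) ∞ B]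
  {ϖ : C^∞⟮𝓘(ℝ, U), B; 𝓘(ℝ, V), M⟯}
  (A : LieAlgebroid V F E) (C : ControlSystem F E ϖ)

/-- The prolongation of `pr₁` at a point, as a linear map. -/
def prolPr₁Linear (q : ControlTot F E ϖ) :
    prol (controlModel U F) A (baseProj ϖ) q →ₗ[ℝ]
      prol (dualModel V F) A (TotalSpace.proj : DualTot F E → M) (pr₁ q) where
  toFun := prolPr₁ A q
  map_add' _ _ := Subtype.ext (Prod.ext rfl
    (ContinuousLinearMap.map_add (mfderiv (controlModel U F) (dualModel V F) pr₁ q) _ _))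
  map_smul' _ _ := Subtype.ext (Prod.ext rfl
    (ContinuousLinearMap.map_smul (mfderiv (controlModel U F) (dualModel V F) pr₁ q) _ _))

/-- The differential of the Hamiltonian at a point, as a linear functional. -/
def dHamiltonianLinear (q : ControlTot F E ϖ) :
    prol (controlModel U F) A (baseProj ϖ) q →ₗ[ℝ] ℝ where
  toFun := C.dHamiltonian A q
  map_add' _ _ :=
    ContinuousLinearMap.map_add (mfderiv (controlModel U F) 𝓘(ℝ, ℝ) C.hamiltonian q) _ _
  map_smul' _ _ :=
    ContinuousLinearMap.map_smul (mfderiv (controlModel U F) 𝓘(ℝ, ℝ) C.hamiltonian q) _ _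

/-- A pair over an element of `𝒯ᴱE*` is an element of `𝒯ᴱ(E* ×_M B)`. -/
lemma mem_prol_of_mfderiv_pr₁_eq (q : ControlTot F E ϖ)
    (z : prol (dualModel V F) A (TotalSpace.proj : DualTot F E → M) (pr₁ q))
    (v : TangentSpace (controlModel U F) q)
    (hv : mfderiv (controlModel U F) (dualModel V F) pr₁ q v = z.1.2) :
    ((z.1.1, v) : E (baseProj ϖ q) × TangentSpace (controlModel U F) q) ∈
      prol (controlModel U F) A (baseProj ϖ) q := by
  have h₁ : A.anchor (ϖ q.proj) z.1.1 = _ := z.2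
  have h₂ := mfderiv_dual_proj (pr₁ q) z.1.2
  have h₃ := mfderiv_baseProj q v
  have h₄ := mfderiv_pr₁ q v
  refine h₁.trans (h₂.trans (Eq.trans ?_ h₃.symm))
  exact congrArg (fun w : V × (F →L[ℝ] ℝ) => w.1) (hv.symm.trans h₄)

lemma exists_prolPr₁_eq (q : ControlTot F E ϖ)
    (z : prol (dualModel V F) A (TotalSpace.proj : DualTot F E → M) (pr₁ q))
    (v : TangentSpace (controlModel U F) q)
    (hv : mfderiv (controlModel U F) (dualModel V F) pr₁ q v = z.1.2) :
    ∃ y : prol (controlModel U F) A (baseProj ϖ) q, y.1.2 = v ∧ prolPr₁ A q y = z :=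
  ⟨⟨_, mem_prol_of_mfderiv_pr₁_eq A q z v hv⟩, rfl, Subtype.ext (Prod.ext rfl hv)⟩

/-- In coordinates `T pr₁` is `Tϖ` times the identity of the fibre part, hence onto; the anchor
condition upstairs follows from the one downstairs. -/
lemma prolPr₁_surjective (hϖ : IsSubmersive ϖ) (q : ControlTot F E ϖ) :
    Function.Surjective (prolPr₁ A q) := by
  intro z
  obtain ⟨u, hu⟩ := hϖ q.proj (z.1.2 : V × (F →L[ℝ] ℝ)).1
  obtain ⟨y, -, hy⟩ := exists_prolPr₁_eq A q z
    ((u, (z.1.2 : V × (F →L[ℝ] ℝ)).2) : U × (F →L[ℝ] ℝ))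
    ((mfderiv_pr₁ q _).trans (Prod.ext hu rfl))
  exact ⟨y, hy⟩

variable [FiniteDimensional ℝ V] [T2Space M] [FiniteDimensional ℝ F]

/-- Criticality says that `dH` vanishes on `ker 𝒯pr₁`, so it factors through the surjection `𝒯pr₁`
as a functional on the fibre of `𝒯ᴱE*`. The factor is `dH ∘ s` for a linear right inverse `s`, and
nondegeneracy of `Ω` represents it by a unique `z`. -/
lemma existsUnique_symplecticEq (hϖ : IsSubmersive ϖ) (q : ControlTot F E ϖ)
    (hq : q ∈ C.criticalSet A) : ∃! z, C.SymplecticEq A q z := by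
  obtain ⟨s, hs⟩ := (prolPr₁Linear A q).exists_rightInverse_of_surjective
    (LinearMap.range_eq_top.2 (prolPr₁_surjective A hϖ q))
  have hs' : ∀ x, prolPr₁Linear A q (s x) = x := LinearMap.congr_fun hs
  have key : ∀ y, dHamiltonianLinear A C q y =
      dHamiltonianLinear A C q (s (prolPr₁Linear A q y)) := fun y => by
    rw [← sub_eq_zero, ← map_sub]
    apply hq
    change prolPr₁Linear A q _ = 0
    rw [map_sub, hs', sub_self]
  have iff : ∀ z, canonicalBilin A (pr₁ q) z = dHamiltonianLinear A C q ∘ₗ s ↔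
      C.SymplecticEq A q z := fun z => by
    refine ⟨fun h y => (LinearMap.congr_fun h (prolPr₁Linear A q y)).trans (key y).symm,
      fun h => LinearMap.ext fun x => ?_⟩
    have := h (s x)
    rw [show prolPr₁ A q (s x) = x from hs' x] at this
    exact this
  obtain ⟨z, hz, huniq⟩ :=
    (canonicalBilin_bijective A (pr₁ q)).existsUnique (dHamiltonianLinear A C q ∘ₗ s)
  exact ⟨z, (iff z).1 hz, fun z' hz' => huniq z' ((iff z').2 hz')⟩

end Symplectic

/-! ### Smoothness of operator-valued maps. -/

section ClmSmooth

open scoped Topology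

variable {EN : Type*} [NormedAddCommGroup EN] [NormedSpace ℝ EN] {HN : Type*} [TopologicalSpace HN]
  {IN : ModelWithCorners ℝ EN HN} {N : Type*} [TopologicalSpace N] [ChartedSpace HN N]
  {F : Type*} [NormedAddCommGroup F] [NormedSpace ℝ F] [FiniteDimensional ℝ F]
  {F' : Type*} [NormedAddCommGroup F'] [NormedSpace ℝ F']

/-- A basis of `F` identifies `F →L[ℝ] F'` with a finite power of `F'`, where smoothness is
componentwise. -/
lemma contMDiffAt_clm_of_apply {n : WithTop ℕ∞} {g : N → F →L[ℝ] F'} {y : N}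
    (h : ∀ v, ContMDiffAt IN 𝓘(ℝ, F') n (fun z => g z v) y) :
    ContMDiffAt IN 𝓘(ℝ, F →L[ℝ] F') n g y := by
  let d := Module.finrank ℝ F
  have hd : d = Module.finrank ℝ (Fin d → ℝ) := (Module.finrank_fin_fun ℝ).symm
  let e₁ := ContinuousLinearEquiv.ofFinrankEq hd
  let e₂ := (e₁.arrowCongr (1 : F' ≃L[ℝ] F')).trans (ContinuousLinearEquiv.piRing (Fin d))
  have h₂ : ContMDiffAt IN 𝓘(ℝ, Fin d → F') n (e₂ ∘ g) y := contMDiffAt_pi_space.2 fun i => h _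
  have := (e₂.symm.contDiff (n := n)).contMDiff.contMDiffAt.comp y h₂
  rwa [← Function.comp_assoc, e₂.symm_comp_self, Function.id_comp] at this

end ClmSmooth

/-! ### Smoothness of `Φ⁻¹` and of the contragredient map. -/

section Contragredient

open scoped Topology

variable {V : Type*} [NormedAddCommGroup V] [NormedSpace ℝ V]
  {M : Type*} [TopologicalSpace M] [ChartedSpace V M] [IsManifold 𝓘(ℝ, V) ∞ M]
  {F : Type*} [NormedAddCommGroup F] [NormedSpace ℝ F] [FiniteDimensional ℝ F]
  {E : M → Type*} [∀ x, AddCommGroup (E x)] [∀ x, Module ℝ (E x)]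
  [∀ x, TopologicalSpace (E x)] [TopologicalSpace (TotalSpace F E)]
  [FiberBundle F E] [VectorBundle ℝ F E] [ContMDiffVectorBundle ∞ F E 𝓘(ℝ, V)]
  {V' : Type*} [NormedAddCommGroup V'] [NormedSpace ℝ V']
  {M' : Type*} [TopologicalSpace M'] [ChartedSpace V' M'] [IsManifold 𝓘(ℝ, V') ∞ M']
  {F' : Type*} [NormedAddCommGroup F'] [NormedSpace ℝ F'] [FiniteDimensional ℝ F']
  {E' : M' → Type*} [∀ x, AddCommGroup (E' x)] [∀ x, Module ℝ (E' x)]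
  [∀ x, TopologicalSpace (E' x)] [TopologicalSpace (TotalSpace F' E')]
  [FiberBundle F' E'] [VectorBundle ℝ F' E'] [ContMDiffVectorBundle ∞ F' E' 𝓘(ℝ, V')]
  {φ : C^∞⟮𝓘(ℝ, V), M; 𝓘(ℝ, V'), M'⟯}

lemma inCoordinates_dual_apply (x₀ x : M) (f : DualFib E x) (v : F) :
    ContinuousLinearMap.inCoordinates F E ℝ (Bundle.Trivial M ℝ) x₀ x x₀ x f v =
      f ((trivializationAt F E x₀).symmL ℝ x v) := by
  change (trivializationAt ℝ (Bundle.Trivial M ℝ) x₀).continuousLinearMapAt ℝ x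
    (f ((trivializationAt F E x₀).symmL ℝ x v)) = _
  rw [Trivialization.continuousLinearMapAt_apply_of_mem (R := ℝ) _
    (mem_univ x : x ∈ (trivializationAt ℝ (Bundle.Trivial M ℝ) x₀).baseSet)]
  rfl

namespace BundleMap

lemma fiberInv_apply_onFiber (Φ : BundleMap F E F' E' φ) (hΦ : Φ.FiberwiseBijective) (x : M)
    (b : E x) : Φ.fiberInv hΦ x (Φ.onFiber x b) = b :=
  (LinearEquiv.ofBijective (Φ.onFiber x : E x →ₗ[ℝ] E' (φ x)) (hΦ x)).symm_apply_apply b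

lemma onFiber_apply_fiberInv (Φ : BundleMap F E F' E' φ) (hΦ : Φ.FiberwiseBijective) (x : M)
    (b : E' (φ x)) : Φ.onFiber x (Φ.fiberInv hΦ x b) = b :=
  (LinearEquiv.ofBijective (Φ.onFiber x : E x →ₗ[ℝ] E' (φ x)) (hΦ x)).apply_symm_apply b

/-- Smoothness of `Φ` on the total space becomes smoothness of its matrix by applying `Φ` to local
sections with constant coordinates. -/
lemma contMDiffAt_inCoordinates_onFiber (Φ : BundleMap F E F' E' φ) (x₀ : M) :
    ContMDiffAt 𝓘(ℝ, V) 𝓘(ℝ, F →L[ℝ] F') ∞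
      (fun x => ContinuousLinearMap.inCoordinates F E F' E' x₀ x (φ x₀) (φ x) (Φ.onFiber x))
      x₀ := by
  refine contMDiffAt_clm_of_apply fun v => ?_
  let e := trivializationAt F E x₀
  let e' := trivializationAt F' E' (φ x₀)
  have hx : x₀ ∈ e.baseSet := FiberBundle.mem_baseSet_trivializationAt F E x₀
  have hx' : φ x₀ ∈ e'.baseSet := FiberBundle.mem_baseSet_trivializationAt F' E' (φ x₀)
  have hs : ContMDiffOn 𝓘(ℝ, V) (𝓘(ℝ, V).prod 𝓘(ℝ, F)) ∞
      (fun y => (⟨y, e.symm y v⟩ : TotalSpace F E)) e.baseSet := by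
    refine (e.contMDiffOn_section_baseSet_iff).2 ?_
    refine (contMDiffOn_const (c := v)).congr fun y hy => ?_
    rw [e.apply_mk_symm hy]
  have h := (Φ.smooth _).comp x₀ (hs.contMDiffAt (e.open_baseSet.mem_nhds hx))
  have h₂ := (contMDiffAt_totalSpace.1 h).2
  refine h₂.congr_of_eventuallyEq ?_
  filter_upwards [e.open_baseSet.mem_nhds hx,
    φ.contMDiff.continuous.continuousAt.preimage_mem_nhds (e'.open_baseSet.mem_nhds hx')]
    with y hy hy'
  change e'.continuousLinearMapAt ℝ (φ y) (Φ.onFiber y (e.symmL ℝ y v)) =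
    (e' ⟨φ y, Φ.onFiber y (e.symm y v)⟩).2
  rw [Trivialization.continuousLinearMapAt_apply_of_mem (R := ℝ) e' hy', e.symmL_apply hy]

/-- In coordinates `Φ⁻¹` is the operator inverse of `Φ`, and inversion is smooth at an invertible
operator. -/
lemma contMDiffAt_inCoordinates_fiberInv (Φ : BundleMap F E F' E' φ) (hΦ : Φ.FiberwiseBijective)
    (x₀ : M) :
    ContMDiffAt 𝓘(ℝ, V) 𝓘(ℝ, F' →L[ℝ] F) ∞
      (fun x => ContinuousLinearMap.inCoordinates F' E' F E (φ x₀) (φ x) x₀ x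
        (Φ.fiberInv hΦ x)) x₀ := by
  let e := trivializationAt F E x₀
  let e' := trivializationAt F' E' (φ x₀)
  have hx : x₀ ∈ e.baseSet := FiberBundle.mem_baseSet_trivializationAt F E x₀
  have hx' : φ x₀ ∈ e'.baseSet := FiberBundle.mem_baseSet_trivializationAt F' E' (φ x₀)
  let P : M → F →L[ℝ] F' := fun x =>
    ContinuousLinearMap.inCoordinates F E F' E' x₀ x (φ x₀) (φ x) (Φ.onFiber x)
  let Q : M → F' →L[ℝ] F := fun x =>
    ContinuousLinearMap.inCoordinates F' E' F E (φ x₀) (φ x) x₀ x (Φ.fiberInv hΦ x)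
  have hPQ : ∀ x, x ∈ e.baseSet → φ x ∈ e'.baseSet →
      Function.LeftInverse (Q x) (P x) ∧ Function.RightInverse (Q x) (P x) := by
    intro x hy hy'
    constructor
    · intro v
      change e.continuousLinearMapAt ℝ x (Φ.fiberInv hΦ x (e'.symmL ℝ (φ x)
        (e'.continuousLinearMapAt ℝ (φ x) (Φ.onFiber x (e.symmL ℝ x v))))) = v
      rw [e'.symmL_continuousLinearMapAt hy', fiberInv_apply_onFiber,
        e.continuousLinearMapAt_symmL hy]
    · intro v
      change e'.continuousLinearMapAt ℝ (φ x) (Φ.onFiber x (e.symmL ℝ x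
        (e.continuousLinearMapAt ℝ x (Φ.fiberInv hΦ x (e'.symmL ℝ (φ x) v))))) = v
      rw [e.symmL_continuousLinearMapAt hy, onFiber_apply_fiberInv,
        e'.continuousLinearMapAt_symmL hy']
  let L : ∀ x, x ∈ e.baseSet → φ x ∈ e'.baseSet → F ≃L[ℝ] F' := fun x hy hy' =>
    ContinuousLinearEquiv.equivOfInverse (P x) (Q x) (hPQ x hy hy').1 (hPQ x hy hy').2
  have hinv : ContDiffAt ℝ ∞ (ContinuousLinearMap.inverse : (F →L[ℝ] F') → F' →L[ℝ] F) (P x₀) :=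
    contDiffAt_map_inverse (L x₀ hx hx')
  have h := hinv.contMDiffAt.comp x₀ (Φ.contMDiffAt_inCoordinates_onFiber x₀)
  refine h.congr_of_eventuallyEq ?_
  filter_upwards [e.open_baseSet.mem_nhds hx,
    φ.contMDiff.continuous.continuousAt.preimage_mem_nhds (e'.open_baseSet.mem_nhds hx')]
    with y hy hy'
  exact (ContinuousLinearMap.inverse_equiv (L y hy hy')).symm

/-- The pull-back `x ↦ Φ_x⁻¹(t(φ(x)))` of a section. -/
def pullbackSec (Φ : BundleMap F E F' E' φ) (hΦ : Φ.FiberwiseBijective) (t : Sec V' F' E') :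
    Sec V F E :=
  ⟨fun x => Φ.fiberInv hΦ x (t (φ x)), fun x₀ =>
    ContMDiffAt.clm_apply_of_inCoordinates (IB₁ := 𝓘(ℝ, V')) (IB₂ := 𝓘(ℝ, V)) (b₁ := φ) (b₂ := id)
      (Φ.contMDiffAt_inCoordinates_fiberInv hΦ x₀)
      ((t.contMDiff.comp φ.contMDiff) x₀) contMDiffAt_id⟩

lemma onFiber_pullbackSec (Φ : BundleMap F E F' E' φ) (hΦ : Φ.FiberwiseBijective)
    (t : Sec V' F' E') (x : M) : Φ.onFiber x (Φ.pullbackSec hΦ t x) = t (φ x) :=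
  Φ.onFiber_apply_fiberInv hΦ x _

/-- In coordinates `Φᶜ(μ)` is the covector of `μ` composed with the matrix of `Φ⁻¹`; the
intermediate trivialization of `E` cancels. -/
lemma contMDiff_contragredient (Φ : BundleMap F E F' E' φ) (hΦ : Φ.FiberwiseBijective) :
    ContMDiff (dualModel V F) (dualModel V' F') ∞ (Φ.contragredient hΦ) := by
  intro μ₀
  have hproj : ContMDiffAt (dualModel V F) 𝓘(ℝ, V) ∞ (TotalSpace.proj : DualTot F E → M) μ₀ :=
    contMDiff_proj (DualFib E) μ₀
  rw [contMDiffAt_hom_bundle]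
  refine ⟨φ.contMDiff.contMDiffAt.comp μ₀ hproj, ?_⟩
  have h₁ := ((contMDiffAt_hom_bundle (F₁ := F) (E₁ := E) (F₂ := ℝ) (E₂ := Bundle.Trivial M ℝ)
    (IB := 𝓘(ℝ, V)) (IM := dualModel V F) (n := ∞) (id : DualTot F E → DualTot F E)
    (x₀ := μ₀)).1 contMDiffAt_id).2
  have h₂ := (Φ.contMDiffAt_inCoordinates_fiberInv hΦ μ₀.proj).comp μ₀ hproj
  refine (h₁.clm_comp h₂).congr_of_eventuallyEq ?_
  let e := trivializationAt F E μ₀.proj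
  have hx : μ₀.proj ∈ e.baseSet := FiberBundle.mem_baseSet_trivializationAt F E μ₀.proj
  filter_upwards [hproj.continuousAt.preimage_mem_nhds (e.open_baseSet.mem_nhds hx)] with ν hν
  ext v
  have h : e.symmL ℝ ν.proj (e.continuousLinearMapAt ℝ ν.proj (Φ.fiberInv hΦ ν.proj
      ((trivializationAt F' E' (φ μ₀.proj)).symmL ℝ (φ ν.proj) v))) = _ :=
    e.symmL_continuousLinearMapAt hν _
  refine (inCoordinates_dual_apply _ _ _ v).trans (Eq.trans ?_
    (inCoordinates_dual_apply μ₀.proj ν.proj ν.snd _).symm)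
  exact (congrArg (fun b => (ν.snd b : ℝ)) h).symm

end BundleMap

end Contragredient

/-! ### The morphism condition in degrees 0 and 1; `𝒯^Φ Φᶜ` is symplectic. -/

section Morphism

open scoped Topology

variable {V : Type*} [NormedAddCommGroup V] [NormedSpace ℝ V]
  {M : Type*} [TopologicalSpace M] [ChartedSpace V M] [IsManifold 𝓘(ℝ, V) ∞ M]
  {F : Type*} [NormedAddCommGroup F] [NormedSpace ℝ F] [FiniteDimensional ℝ F]
  {E : M → Type*} [∀ x, AddCommGroup (E x)] [∀ x, Module ℝ (E x)]
  [∀ x, TopologicalSpace (E x)] [TopologicalSpace (TotalSpace F E)]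
  [FiberBundle F E] [VectorBundle ℝ F E] [ContMDiffVectorBundle ∞ F E 𝓘(ℝ, V)]
  {V' : Type*} [NormedAddCommGroup V'] [NormedSpace ℝ V']
  {M' : Type*} [TopologicalSpace M'] [ChartedSpace V' M'] [IsManifold 𝓘(ℝ, V') ∞ M']
  {F' : Type*} [NormedAddCommGroup F'] [NormedSpace ℝ F'] [FiniteDimensional ℝ F']
  {E' : M' → Type*} [∀ x, AddCommGroup (E' x)] [∀ x, Module ℝ (E' x)]
  [∀ x, TopologicalSpace (E' x)] [TopologicalSpace (TotalSpace F' E')]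
  [FiberBundle F' E'] [VectorBundle ℝ F' E'] [ContMDiffVectorBundle ∞ F' E' 𝓘(ℝ, V')]
  {φ : C^∞⟮𝓘(ℝ, V), M; 𝓘(ℝ, V'), M'⟯}

/-- Smooth functions separate the vectors of a tangent space. -/
lemma eq_of_dirDeriv_eq [FiniteDimensional ℝ V] [T2Space M] (x : M) (v w : V)
    (h : ∀ f : C^∞⟮𝓘(ℝ, V), M; 𝓘(ℝ, ℝ), ℝ⟯,
      dirDeriv 𝓘(ℝ, V) f x v = dirDeriv 𝓘(ℝ, V) f x w) : v = w := by
  rw [← sub_eq_zero]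
  by_contra hne
  obtain ⟨l, hl⟩ := SeparatingDual.exists_ne_zero (R := ℝ) hne
  rw [map_sub, sub_ne_zero] at hl
  obtain ⟨χ, hχ, hsupp⟩ := exists_cutoff (V := V) x ((chartAt V x).open_source.mem_nhds
    (mem_chart_source V x))
  have hlo : ContMDiffOn 𝓘(ℝ, V) 𝓘(ℝ, ℝ) ∞ (fun y => l (extChartAt 𝓘(ℝ, V) x y))
      (chartAt V x).source :=
    (l.contDiff (n := ∞)).contMDiff.comp_contMDiffOn contMDiffOn_extChartAt
  let f := cutoffFun χ (chartAt V x).open_source hsupp _ hlo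
  -- Near `x`, `f` is `l` composed with the preferred chart, whose derivative at `x` is the
  -- identity.
  have hf : HasMFDerivAt 𝓘(ℝ, V) 𝓘(ℝ, ℝ) f x l := by
    have h₁ : HasMFDerivAt 𝓘(ℝ, V) 𝓘(ℝ, ℝ) (fun y => l (extChartAt 𝓘(ℝ, V) x y)) x
        (l.comp (ContinuousLinearMap.id ℝ V)) := by
      refine HasMFDerivAt.comp x (l.hasMFDerivAt) ?_
      have h₂ := (mdifferentiableAt_extChartAt (I := 𝓘(ℝ, V)) (mem_chart_source V x)).hasMFDerivAt
      rw [mfderiv_extChartAt_self] at h₂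
      exact h₂
    refine h₁.congr_of_eventuallyEq ?_
    filter_upwards [hχ] with y hy
    change χ y * l (extChartAt 𝓘(ℝ, V) x y) = _
    rw [hy]; exact one_mul _
  have := h f
  unfold dirDeriv at this
  rw [hf.mfderiv] at this
  exact hl this

/-- The fibre of `𝒯ᴱE*` in coordinates. -/
def prolDualEquiv (A : LieAlgebroid V F E) (μ : DualTot F E) :
    prol (dualModel V F) A (TotalSpace.proj : DualTot F E → M) μ ≃ₗ[ℝ] F × (F →L[ℝ] ℝ) where
  toFun z := (VectorBundle.continuousLinearEquivAt ℝ F E μ.proj z.1.1,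
    (z.1.2 : V × (F →L[ℝ] ℝ)).2)
  map_add' z z' := Prod.ext (map_add _ _ _) rfl
  map_smul' c z := Prod.ext (map_smul _ _ _) rfl
  invFun a := ⟨((VectorBundle.continuousLinearEquivAt ℝ F E μ.proj).symm a.1,
    ((A.anchor μ.proj ((VectorBundle.continuousLinearEquivAt ℝ F E μ.proj).symm a.1), a.2) :
      V × (F →L[ℝ] ℝ))), (mfderiv_dual_proj (V := V) μ (A.anchor μ.proj
        ((VectorBundle.continuousLinearEquivAt ℝ F E μ.proj).symm a.1), a.2)).symm⟩
  left_inv z := by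
    refine Subtype.ext (Prod.ext ?_ (Prod.ext ?_ rfl))
    · exact (VectorBundle.continuousLinearEquivAt ℝ F E μ.proj).symm_apply_apply _
    · have h := (show A.anchor μ.proj z.1.1 = _ from z.2).trans (mfderiv_dual_proj μ z.1.2)
      refine Eq.trans ?_ h
      exact congrArg (A.anchor μ.proj)
        ((VectorBundle.continuousLinearEquivAt ℝ F E μ.proj).symm_apply_apply _)
  right_inv a := Prod.ext
    ((VectorBundle.continuousLinearEquivAt ℝ F E μ.proj).apply_symm_apply _) rfl

namespace BundleMap

variable {A : LieAlgebroid V F E} {A' : LieAlgebroid V' F' E'} {Φ : BundleMap F E F' E' φ}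

lemma dirDeriv_comp_base (f : M' → ℝ) (hf : ContMDiff 𝓘(ℝ, V') 𝓘(ℝ, ℝ) ∞ f) (x : M)
    (v : TangentSpace 𝓘(ℝ, V) x) :
    dirDeriv 𝓘(ℝ, V) (fun y => f (φ y)) x v =
      dirDeriv 𝓘(ℝ, V') f (φ x) (mfderiv 𝓘(ℝ, V) 𝓘(ℝ, V') φ x v) :=
  mfderiv_comp_apply x (hf.mdifferentiableAt (by simp)) (φ.contMDiff.mdifferentiableAt (by simp)) v

variable [FiniteDimensional ℝ V] [T2Space M] [FiniteDimensional ℝ V'] [T2Space M']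

/-- For 0-forms, `Φ⋆(df) = d(f ∘ φ)` compares the two vectors as derivations on smooth functions,
and these separate tangent vectors. -/
lemma anchor_onFiber (hmor : Φ.IsMorphism A A') (x : M) (b : E x) :
    A'.anchor (φ x) (Φ.onFiber x b) = mfderiv 𝓘(ℝ, V) 𝓘(ℝ, V') φ x (A.anchor x b) := by
  refine eq_of_dirDeriv_eq (V := V') (φ x) _ _ fun f => ?_
  obtain ⟨s, hs⟩ := exists_sec_apply_eq (V := V) (F := F) x b
  obtain ⟨t, ht⟩ := exists_sec_apply_eq (V := V') (F := F') (φ x) (Φ.onFiber x b)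
  have h := hmor 0 (fun y => AlternatingMap.constOfIsEmpty ℝ (E' y) (Fin 0) (f y))
    (fun _ => f.contMDiff) (fun _ => s) (fun _ => t) x (fun _ => by rw [ht, hs])
  have h' : dirDeriv 𝓘(ℝ, V') f (φ x) (A'.anchor (φ x) (t (φ x))) =
      dirDeriv 𝓘(ℝ, V) (fun y => f (φ y)) x (A.anchor x (s x)) := by
    simpa [LieAlgebroid.extD, LieAlgebroid.bracketSum, LieAlgebroid.lieD, pullbackForm] using h
  rw [dirDeriv_comp_base f f.contMDiff, ht, hs] at h'
  exact h'

lemma lieD_comp_base (hmor : Φ.IsMorphism A A') (f : M' → ℝ)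
    (hf : ContMDiff 𝓘(ℝ, V') 𝓘(ℝ, ℝ) ∞ f) (s : Sec V F E) (t : Sec V' F' E') (x : M)
    (hst : t (φ x) = Φ.onFiber x (s x)) :
    A.lieD s (fun y => f (φ y)) x = A'.lieD t f (φ x) := by
  unfold LieAlgebroid.lieD
  rw [dirDeriv_comp_base f hf, hst, anchor_onFiber hmor]

/-- A fibrewise bijective morphism intertwines the brackets of sections with their
pull-backs. -/
lemma onFiber_bracket_pullbackSec (hmor : Φ.IsMorphism A A') (hΦ : Φ.FiberwiseBijective)
    (t₁ t₂ : Sec V' F' E') (x : M) :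
    Φ.onFiber x (A.bracket (Φ.pullbackSec hΦ t₁) (Φ.pullbackSec hΦ t₂) x) =
      A'.bracket t₁ t₂ (φ x) := by
  have key : ∀ ν : DualFib E' (φ x), (ν (Φ.onFiber x
      (A.bracket (Φ.pullbackSec hΦ t₁) (Φ.pullbackSec hΦ t₂) x)) : ℝ) =
      ν (A'.bracket t₁ t₂ (φ x)) := fun ν => by
    obtain ⟨α, hα⟩ := exists_sec_apply_eq (V := V') (F := F' →L[ℝ] ℝ) (φ x) ν
    let a : ∀ y, E' y →ₗ[ℝ] ℝ := fun y => (α y : E' y →ₗ[ℝ] ℝ)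
    let θ : Form E' 1 := fun y => AlternatingMap.ofSubsingleton ℝ (E' y) ℝ (0 : Fin 1) (a y)
    have hpair : ∀ t : Sec V' F' E', ContMDiff 𝓘(ℝ, V') 𝓘(ℝ, ℝ) ∞ (fun y => a y (t y)) :=
      fun t => contMDiff_dualPairing (V := V') (F := F') (fun y => y) (fun y => α y)
        (fun y => t y) α.contMDiff t.contMDiff
    have hst : ∀ t : Sec V' F' E', ∀ y, Φ.onFiber y (Φ.pullbackSec hΦ t y) = t (φ y) :=
      fun t y => Φ.onFiber_pullbackSec hΦ t y
    -- Apply the morphism condition to a one-form extending `ν`. The two derivative terms agree by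
    -- compatibility with the anchors, so the bracket terms agree as well.
    have h := hmor 1 θ (fun s => hpair (s 0)) ![Φ.pullbackSec hΦ t₁, Φ.pullbackSec hΦ t₂]
      ![t₁, t₂] x (fun i => by fin_cases i <;> exact (hst _ _).symm)
    have h₁ : A'.extD θ ![t₁, t₂] (φ x) =
        A'.lieD t₁ (fun y => a y (t₂ y)) (φ x) - A'.lieD t₂ (fun y => a y (t₁ y)) (φ x) -
          a (φ x) (A'.bracket t₁ t₂ (φ x)) := by
      simp [LieAlgebroid.extD, LieAlgebroid.bracketSum, Fin.sum_univ_two, θ]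
      ring
    have h₂ : A.extD (Φ.pullbackForm θ) ![Φ.pullbackSec hΦ t₁, Φ.pullbackSec hΦ t₂] x =
        A.lieD (Φ.pullbackSec hΦ t₁) (fun y => a (φ y) (t₂ (φ y))) x -
        A.lieD (Φ.pullbackSec hΦ t₂) (fun y => a (φ y) (t₁ (φ y))) x -
          a (φ x) (Φ.onFiber x
            (A.bracket (Φ.pullbackSec hΦ t₁) (Φ.pullbackSec hΦ t₂) x)) := by
      simp [LieAlgebroid.extD, LieAlgebroid.bracketSum, Fin.sum_univ_two, θ, pullbackForm, hst]
      ring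
    rw [h₁, h₂, lieD_comp_base hmor (fun y => a y (t₂ y)) (hpair t₂) _ t₁ x (hst _ _).symm,
      lieD_comp_base hmor (fun y => a y (t₁ y)) (hpair t₁) _ t₂ x (hst _ _).symm] at h
    have h₃ := sub_right_injective h
    have h₄ : a (φ x) = (ν : E' (φ x) →ₗ[ℝ] ℝ) := by simp only [a, hα]
    rw [h₄] at h₃
    exact h₃.symm
  let e := VectorBundle.continuousLinearEquivAt ℝ F' E' (φ x)
  apply e.injective
  rw [← sub_eq_zero]
  by_contra hne
  obtain ⟨f, hf⟩ := SeparatingDual.exists_ne_zero (R := ℝ) hne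
  rw [map_sub, sub_ne_zero] at hf
  exact hf (key (f.comp (e : E' (φ x) →L[ℝ] F')))

/-- By definition of `Φᶜ`, `fibreLinear t ∘ Φᶜ` is `fibreLinear` of the pull-back of `t`; the rest
is the chain rule. -/
lemma dirDeriv_fibreLinear_contragredient (Φ : BundleMap F E F' E' φ) (hΦ : Φ.FiberwiseBijective)
    (t : Sec V' F' E') (μ : DualTot F E) (w : TangentSpace (dualModel V F) μ) :
    dirDeriv (dualModel V' F') (fibreLinear t) (Φ.contragredient hΦ μ)
      (mfderiv (dualModel V F) (dualModel V' F') (Φ.contragredient hΦ) μ w) =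
    dirDeriv (dualModel V F) (fibreLinear (Φ.pullbackSec hΦ t)) μ w :=
  (mfderiv_comp_apply μ (mdifferentiableAt_fibreLinear t _)
    ((Φ.contMDiff_contragredient hΦ).mdifferentiableAt (by simp)) w).symm

/-- The prolongation `𝒯^Φ Φᶜ` as a map between the fibres. -/
def prolMap (hmor : Φ.IsMorphism A A') (hΦ : Φ.FiberwiseBijective) (μ : DualTot F E) :
    prol (dualModel V F) A (TotalSpace.proj : DualTot F E → M) μ →ₗ[ℝ]
      prol (dualModel V' F') A' (TotalSpace.proj : DualTot F' E' → M')
        (Φ.contragredient hΦ μ) where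
  toFun z := ⟨(Φ.onFiber μ.proj z.1.1,
    mfderiv (dualModel V F) (dualModel V' F') (Φ.contragredient hΦ) μ z.1.2), by
      have hz : A.anchor μ.proj z.1.1 = _ := z.2
      have h₁ := mfderiv_comp_apply μ
        ((contMDiff_proj (n := ∞) (DualFib E') (F := F' →L[ℝ] ℝ) (IB := 𝓘(ℝ, V'))).mdifferentiableAt
          (x := Φ.contragredient hΦ μ) (by simp))
        ((Φ.contMDiff_contragredient hΦ).mdifferentiableAt (by simp)) z.1.2
      have h₂ := mfderiv_comp_apply μ (φ.contMDiff.mdifferentiableAt (x := μ.proj) (by simp))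
        ((contMDiff_proj (n := ∞) (DualFib E) (F := F →L[ℝ] ℝ) (IB := 𝓘(ℝ, V))).mdifferentiableAt
          (x := μ) (by simp)) z.1.2
      have h₃ := anchor_onFiber hmor μ.proj z.1.1
      rw [hz] at h₃
      exact h₃.trans (h₂.symm.trans h₁)⟩
  map_add' _ _ := Subtype.ext (Prod.ext (map_add _ _ _)
    (ContinuousLinearMap.map_add
      (mfderiv (dualModel V F) (dualModel V' F') (Φ.contragredient hΦ) μ) _ _))
  map_smul' _ _ := Subtype.ext (Prod.ext (map_smul _ _ _)
    (ContinuousLinearMap.map_smul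
      (mfderiv (dualModel V F) (dualModel V' F') (Φ.contragredient hΦ) μ) _ _))

/-- Extend `Φ(bᵢ)` to sections `tᵢ` of `E'` and use their pull-backs as the sections through `bᵢ`;
the formulas for the two forms then agree term by term. -/
lemma canonicalForm_prolMap (hmor : Φ.IsMorphism A A') (hΦ : Φ.FiberwiseBijective)
    (μ : DualTot F E)
    (z₁ z₂ : prol (dualModel V F) A (TotalSpace.proj : DualTot F E → M) μ) :
    canonicalForm A' (Φ.contragredient hΦ μ) (prolMap hmor hΦ μ z₁) (prolMap hmor hΦ μ z₂) =
      canonicalForm A μ z₁ z₂ := by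
  obtain ⟨t₁, ht₁⟩ := exists_sec_apply_eq (V := V') (F := F') (φ μ.proj)
    (Φ.onFiber μ.proj z₁.1.1)
  obtain ⟨t₂, ht₂⟩ := exists_sec_apply_eq (V := V') (F := F') (φ μ.proj)
    (Φ.onFiber μ.proj z₂.1.1)
  have hs₁ : Φ.pullbackSec hΦ t₁ μ.proj = z₁.1.1 :=
    (congrArg (Φ.fiberInv hΦ μ.proj) ht₁).trans (Φ.fiberInv_apply_onFiber hΦ _ _)
  have hs₂ : Φ.pullbackSec hΦ t₂ μ.proj = z₂.1.1 :=
    (congrArg (Φ.fiberInv hΦ μ.proj) ht₂).trans (Φ.fiberInv_apply_onFiber hΦ _ _)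
  rw [canonicalForm_eq A' _ _ _ t₁ t₂ ht₁ ht₂, canonicalForm_eq A μ z₁ z₂ _ _ hs₁ hs₂]
  have d₁ := dirDeriv_fibreLinear_contragredient Φ hΦ t₁ μ z₂.1.2
  have d₂ := dirDeriv_fibreLinear_contragredient Φ hΦ t₂ μ z₁.1.2
  have hb : (Φ.contragredient hΦ μ).snd (A'.bracket t₁ t₂ (φ μ.proj)) =
      (μ.snd (A.bracket (Φ.pullbackSec hΦ t₁) (Φ.pullbackSec hΦ t₂) μ.proj) : ℝ) := by
    rw [← onFiber_bracket_pullbackSec hmor hΦ]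
    exact congrArg (fun b => (μ.snd b : ℝ)) (Φ.fiberInv_apply_onFiber hΦ _ _)
  exact congrArg₂ (· - ·) d₁ (congrArg₂ (fun a b : ℝ => a - b) d₂ hb)

/-- A linear map preserving a nondegenerate form has no kernel. -/
lemma prolMap_injective (hmor : Φ.IsMorphism A A') (hΦ : Φ.FiberwiseBijective)
    (μ : DualTot F E) : Function.Injective (prolMap hmor hΦ μ) := by
  rw [← LinearMap.ker_eq_bot, LinearMap.ker_eq_bot']
  intro z hz
  apply canonicalBilin_injective A μ
  rw [map_zero]
  ext z'
  have h := canonicalForm_prolMap hmor hΦ μ z z'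
  rw [hz, ← canonicalBilin_apply, map_zero] at h
  exact h.symm

/-- The fibre of `𝒯ᴱE*` is coordinatised by `F × F*` alone, its base direction being determined by
the anchor. Since `Φ` identifies `F` with `F'`, the dimensions agree even if `φ` is not a local
diffeomorphism. -/
lemma prolMap_bijective (hmor : Φ.IsMorphism A A') (hΦ : Φ.FiberwiseBijective)
    (μ : DualTot F E) : Function.Bijective (prolMap hmor hΦ μ) := by
  refine ⟨prolMap_injective hmor hΦ μ, ?_⟩
  have e : F ≃ₗ[ℝ] F' :=
    (VectorBundle.continuousLinearEquivAt ℝ F E μ.proj).symm.toLinearEquiv ≪≫ₗ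
      LinearEquiv.ofBijective (Φ.onFiber μ.proj : E μ.proj →ₗ[ℝ] E' (φ μ.proj)) (hΦ μ.proj) ≪≫ₗ
      (VectorBundle.continuousLinearEquivAt ℝ F' E' (φ μ.proj)).toLinearEquiv
  have e' : (F →L[ℝ] ℝ) ≃ₗ[ℝ] (F' →L[ℝ] ℝ) :=
    (e.toContinuousLinearEquiv.arrowCongr (ContinuousLinearEquiv.refl ℝ ℝ)).toLinearEquiv
  exact (LinearMap.injective_iff_surjective_of_finrank_eq_finrank
    ((prolDualEquiv A μ) ≪≫ₗ (e.prodCongr e') ≪≫ₗ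
      (prolDualEquiv A' (Φ.contragredient hΦ μ)).symm).finrank_eq).1 (prolMap_injective hmor hΦ μ)

end BundleMap

end Morphism

/-! ### Transport between fibres of `𝒯ᴱE*` over propositionally equal points. -/

section ProlCast

variable {V : Type*} [NormedAddCommGroup V] [NormedSpace ℝ V]
  {M : Type*} [TopologicalSpace M] [ChartedSpace V M] [IsManifold 𝓘(ℝ, V) ∞ M]
  {F : Type*} [NormedAddCommGroup F] [NormedSpace ℝ F]
  {E : M → Type*} [∀ x, AddCommGroup (E x)] [∀ x, Module ℝ (E x)]
  [∀ x, TopologicalSpace (E x)] [TopologicalSpace (TotalSpace F E)]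
  [FiberBundle F E] [VectorBundle ℝ F E] [ContMDiffVectorBundle ∞ F E 𝓘(ℝ, V)]
  {A : LieAlgebroid V F E} {μ ν : DualTot F E}

/-- Transport of elements of `𝒯ᴱE*` along an equality of points. -/
def prolCast (h : μ = ν) (z : prol (dualModel V F) A (TotalSpace.proj : DualTot F E → M) μ) :
    prol (dualModel V F) A (TotalSpace.proj : DualTot F E → M) ν := h ▸ z

/-- All tangent spaces of `E*` are the same model space, so tangent components can be compared
without a cast. -/
lemma prolCast_snd (h : μ = ν)
    (z : prol (dualModel V F) A (TotalSpace.proj : DualTot F E → M) μ) :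
    ((prolCast h z).1.2 : V × (F →L[ℝ] ℝ)) = z.1.2 := by
  subst h; rfl

lemma prolCast_symm_prolCast (h : μ = ν)
    (z : prol (dualModel V F) A (TotalSpace.proj : DualTot F E → M) μ) :
    prolCast h.symm (prolCast h z) = z := by
  subst h; rfl

lemma canonicalForm_prolCast (h : μ = ν)
    (z₁ z₂ : prol (dualModel V F) A (TotalSpace.proj : DualTot F E → M) μ) :
    canonicalForm A ν (prolCast h z₁) (prolCast h z₂) = canonicalForm A μ z₁ z₂ := by
  subst h; rfl

lemma sigma_prolCast (h : μ = ν)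
    (z : prol (dualModel V F) A (TotalSpace.proj : DualTot F E → M) μ) :
    (⟨ν, (prolCast h z).1⟩ :
      Σ ν : DualTot F E, E ν.proj × TangentSpace (dualModel V F) ν) = ⟨μ, z.1⟩ := by
  subst h; rfl

end ProlCast

/-! ### The map `Ψ` and the reduction of critical data. -/

section Reduction

variable {V : Type*} [NormedAddCommGroup V] [NormedSpace ℝ V]
  {M : Type*} [TopologicalSpace M] [ChartedSpace V M] [IsManifold 𝓘(ℝ, V) ∞ M]
  {F : Type*} [NormedAddCommGroup F] [NormedSpace ℝ F] [FiniteDimensional ℝ F]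
  {E : M → Type*} [∀ x, AddCommGroup (E x)] [∀ x, Module ℝ (E x)]
  [∀ x, TopologicalSpace (E x)] [TopologicalSpace (TotalSpace F E)]
  [FiberBundle F E] [VectorBundle ℝ F E] [ContMDiffVectorBundle ∞ F E 𝓘(ℝ, V)]
  {U : Type*} [NormedAddCommGroup U] [NormedSpace ℝ U]
  {B : Type*} [TopologicalSpace B] [ChartedSpace U B] [IsManifold 𝓘(ℝ, U) ∞ B]
  {V' : Type*} [NormedAddCommGroup V'] [NormedSpace ℝ V']
  {M' : Type*} [TopologicalSpace M'] [ChartedSpace V' M'] [IsManifold 𝓘(ℝ, V') ∞ M']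
  {F' : Type*} [NormedAddCommGroup F'] [NormedSpace ℝ F'] [FiniteDimensional ℝ F']
  {E' : M' → Type*} [∀ x, AddCommGroup (E' x)] [∀ x, Module ℝ (E' x)]
  [∀ x, TopologicalSpace (E' x)] [TopologicalSpace (TotalSpace F' E')]
  [FiberBundle F' E'] [VectorBundle ℝ F' E'] [ContMDiffVectorBundle ∞ F' E' 𝓘(ℝ, V')]
  {U' : Type*} [NormedAddCommGroup U'] [NormedSpace ℝ U']
  {B' : Type*} [TopologicalSpace B'] [ChartedSpace U' B'] [IsManifold 𝓘(ℝ, U') ∞ B']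
  {φ : C^∞⟮𝓘(ℝ, V), M; 𝓘(ℝ, V'), M'⟯}
  {ϖ : C^∞⟮𝓘(ℝ, U), B; 𝓘(ℝ, V), M⟯} {ϖ' : C^∞⟮𝓘(ℝ, U'), B'; 𝓘(ℝ, V'), M'⟯}
  {A : LieAlgebroid V F E} {A' : LieAlgebroid V' F' E'}
  {C : ControlSystem F E ϖ} {C' : ControlSystem F' E' ϖ'}
  {Φ : BundleMap F E F' E' φ} (hΦ : Φ.FiberwiseBijective)
  (ψ : C^∞⟮𝓘(ℝ, U), B; 𝓘(ℝ, U'), B'⟯) (hψ : ∀ u, ϖ' (ψ u) = φ (ϖ u))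

lemma ControlSystem.contMDiff_hamiltonian (C : ControlSystem F E ϖ) :
    ContMDiff (controlModel U F) 𝓘(ℝ, ℝ) ∞ C.hamiltonian := by
  have hproj : ContMDiff (controlModel U F) 𝓘(ℝ, U) ∞
      (TotalSpace.proj : ControlTot F E ϖ → B) := contMDiff_proj _
  refine ContMDiff.sub ?_ (C.index.contMDiff.comp hproj)
  exact contMDiff_dualPairing (V := V) (F := F) (fun q : ControlTot F E ϖ => ϖ q.proj)
    (fun q => (pr₁ q).snd) (fun q => C.section_ q.proj) contMDiff_pr₁
    (C.smooth_section.comp hproj)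

namespace BundleMap

/-- On the pull-back bundle smoothness splits into that of the base part, given by `ψ`, and that of
the fibre coordinate, shared with `Φᶜ ∘ pr₁`. -/
lemma contMDiff_controlMap :
    ContMDiff (controlModel U F) (controlModel U' F') ∞
      (Φ.controlMap hΦ ψ hψ : ControlTot F E ϖ → ControlTot F' E' ϖ') := by
  intro q₀
  have hproj : ContMDiff (controlModel U F) 𝓘(ℝ, U) ∞
      (TotalSpace.proj : ControlTot F E ϖ → B) := contMDiff_proj _
  have h : ContMDiffAt (controlModel U F) (dualModel V' F') ∞
      (fun q : ControlTot F E ϖ => pr₁ (Φ.controlMap hΦ ψ hψ q)) q₀ := by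
    have : (fun q : ControlTot F E ϖ => pr₁ (Φ.controlMap hΦ ψ hψ q)) =
        Φ.contragredient hΦ ∘ pr₁ := funext fun q => Φ.pr₁_controlMap hΦ ψ hψ q
    rw [this]
    exact ((Φ.contMDiff_contragredient hΦ).comp contMDiff_pr₁) q₀
  rw [contMDiffAt_totalSpace] at h ⊢
  exact ⟨(ψ.contMDiff.comp hproj) q₀, h.2⟩

lemma mfderiv_proj_controlMap (q : ControlTot F E ϖ) (v : U × (F →L[ℝ] ℝ)) :
    (mfderiv (controlModel U F) (controlModel U' F') (Φ.controlMap hΦ ψ hψ) q v :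
      U' × (F' →L[ℝ] ℝ)).1 = mfderiv 𝓘(ℝ, U) 𝓘(ℝ, U') ψ q.proj v.1 := by
  have hproj : ContMDiff (controlModel U F) 𝓘(ℝ, U) ∞
      (TotalSpace.proj : ControlTot F E ϖ → B) := contMDiff_proj _
  have hproj' : ContMDiff (controlModel U' F') 𝓘(ℝ, U') ∞
      (TotalSpace.proj : ControlTot F' E' ϖ' → B') := contMDiff_proj _
  have h₁ := mfderiv_comp_apply q (hproj'.mdifferentiableAt (by simp))
    ((contMDiff_controlMap hΦ ψ hψ).mdifferentiableAt (by simp)) v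
  have h₂ := mfderiv_comp_apply q (ψ.contMDiff.mdifferentiableAt (x := q.proj) (by simp))
    (hproj.mdifferentiableAt (x := q) (by simp)) v
  rw [mfderiv_control_proj q v] at h₂
  exact (mfderiv_control_proj (Φ.controlMap hΦ ψ hψ q) _).symm.trans (h₁.symm.trans h₂)

lemma mfderiv_pr₁_controlMap (q : ControlTot F E ϖ) (v : TangentSpace (controlModel U F) q) :
    (mfderiv (controlModel U' F') (dualModel V' F') pr₁ (Φ.controlMap hΦ ψ hψ q)
      (mfderiv (controlModel U F) (controlModel U' F') (Φ.controlMap hΦ ψ hψ) q v) :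
      V' × (F' →L[ℝ] ℝ)) =
    mfderiv (dualModel V F) (dualModel V' F') (Φ.contragredient hΦ) (pr₁ q)
      (mfderiv (controlModel U F) (dualModel V F) pr₁ q v) := by
  have h₁ := mfderiv_comp_apply q (contMDiff_pr₁.mdifferentiableAt (by simp))
    ((contMDiff_controlMap (ϖ' := ϖ') hΦ ψ hψ).mdifferentiableAt (by simp)) v
  have h₂ := mfderiv_comp_apply q
    ((Φ.contMDiff_contragredient hΦ).mdifferentiableAt (x := pr₁ q) (by simp))
    (contMDiff_pr₁.mdifferentiableAt (x := q) (by simp)) v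
  have h₃ : (pr₁ ∘ Φ.controlMap hΦ ψ hψ : ControlTot F E ϖ → DualTot F' E') =
      Φ.contragredient hΦ ∘ pr₁ := funext fun q => Φ.pr₁_controlMap hΦ ψ hψ q
  refine h₁.symm.trans (Eq.trans ?_ h₂)
  rw [h₃]

variable (hσ : ∀ u, (⟨φ (ϖ u), Φ.onFiber (ϖ u) (C.section_ u)⟩ : TotalSpace F' E') =
      ⟨ϖ' (ψ u), C'.section_ (ψ u)⟩)
  (hL : ∀ u, C.index u = C'.index (ψ u))

include hσ hL

/-- The contragredient preserves pairings: `⟨Φᶜ(μ), Φ(σ(u))⟩ = ⟨μ, σ(u)⟩`. -/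
lemma hamiltonian_controlMap (q : ControlTot F E ϖ) :
    C'.hamiltonian (Φ.controlMap hΦ ψ hψ q) = C.hamiltonian q := by
  -- The two pairings live in fibres over points that are only propositionally equal; generalising
  -- the points allows the equality to be substituted.
  have key : ∀ (μ ν : DualTot F' E') (a : E' μ.proj) (b : E' ν.proj), μ = ν →
      (⟨μ.proj, a⟩ : TotalSpace F' E') = ⟨ν.proj, b⟩ → (μ.snd a : ℝ) = ν.snd b := by
    rintro μ _ a b rfl h
    rw [TotalSpace.mk_inj] at h
    rw [h]
  have h := key _ _ (C'.section_ (ψ q.proj)) (Φ.onFiber (ϖ q.proj) (C.section_ q.proj))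
    (Φ.pr₁_controlMap hΦ ψ hψ q) (by exact (hσ q.proj).symm)
  have h' : ((Φ.contragredient hΦ (pr₁ q)).snd (Φ.onFiber (ϖ q.proj) (C.section_ q.proj)) : ℝ) =
      (pr₁ q).snd (C.section_ q.proj) :=
    congrArg (fun b => ((pr₁ q).snd b : ℝ)) (Φ.fiberInv_apply_onFiber hΦ _ _)
  exact congrArg₂ (fun a b : ℝ => a - b) (h.trans h') (hL q.proj).symm

lemma dirDeriv_hamiltonian_controlMap (q : ControlTot F E ϖ)
    (v : TangentSpace (controlModel U F) q) :
    dirDeriv (controlModel U' F') C'.hamiltonian (Φ.controlMap hΦ ψ hψ q)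
      (mfderiv (controlModel U F) (controlModel U' F') (Φ.controlMap hΦ ψ hψ) q v) =
    dirDeriv (controlModel U F) C.hamiltonian q v := by
  have h := mfderiv_comp_apply q (C'.contMDiff_hamiltonian.mdifferentiableAt (by simp))
    ((contMDiff_controlMap (ϖ' := ϖ') hΦ ψ hψ).mdifferentiableAt (by simp)) v
  have h' : C'.hamiltonian ∘ Φ.controlMap hΦ ψ hψ = C.hamiltonian :=
    funext (hamiltonian_controlMap hΦ ψ hψ hσ hL)
  refine h.symm.trans ?_
  rw [h']; rfl

/-- An element of `ker 𝒯pr₁` at `Ψ(q)` is a vector tangent to the fibre of `B'`. It lifts through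
`Tψ` to a vector `w` tangent to the fibre of `B`, and `(w, 0)` defines an element of `ker 𝒯pr₁` at
`q`, where `dH` vanishes. Then `H = H' ∘ Ψ` gives the claim. -/
lemma controlMap_mem_criticalSet (hsub : FiberwiseSubmersive ϖ ϖ' ψ) {q : ControlTot F E ϖ}
    (hq : q ∈ C.criticalSet A) : Φ.controlMap hΦ ψ hψ q ∈ C'.criticalSet A' := by
  intro y' hy'
  have hv' : mfderiv (controlModel U' F') (dualModel V' F') pr₁ (Φ.controlMap hΦ ψ hψ q) y'.1.2 =
      0 := congrArg (fun z => z.1.2) hy'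
  have hv'' := (mfderiv_pr₁ (Φ.controlMap hΦ ψ hψ q) y'.1.2).symm.trans hv'
  obtain ⟨w, hw, hw'⟩ := hsub q.proj (y'.1.2 : U' × (F' →L[ℝ] ℝ)).1
    (congrArg (fun a : V' × (F' →L[ℝ] ℝ) => a.1) hv'')
  have hβ : (y'.1.2 : U' × (F' →L[ℝ] ℝ)).2 = 0 :=
    congrArg (fun a : V' × (F' →L[ℝ] ℝ) => a.2) hv''
  have hpr : mfderiv (controlModel U F) (dualModel V F) pr₁ q ((w, 0) : U × (F →L[ℝ] ℝ)) = 0 :=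
    (mfderiv_pr₁ q _).trans (Prod.ext hw rfl)
  obtain ⟨y, hy, hy0⟩ := exists_prolPr₁_eq A q 0 ((w, 0) : U × (F →L[ℝ] ℝ)) hpr
  have hΨ : mfderiv (controlModel U F) (controlModel U' F') (Φ.controlMap hΦ ψ hψ) q
      ((w, 0) : U × (F →L[ℝ] ℝ)) = y'.1.2 := by
    -- The fibre part of `TΨ(w, 0)` is visible after `T pr₁`, where it equals `TΦᶜ(T pr₁(w, 0)) =
    -- TΦᶜ(0)`.
    refine Prod.ext ((mfderiv_proj_controlMap hΦ ψ hψ q (w, 0)).trans hw') ?_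
    have h₁ := mfderiv_pr₁_controlMap hΦ ψ hψ q ((w, 0) : U × (F →L[ℝ] ℝ))
    rw [hpr] at h₁
    replace h₁ := h₁.trans (ContinuousLinearMap.map_zero
      (mfderiv (dualModel V F) (dualModel V' F') (Φ.contragredient hΦ) (pr₁ q)))
    have h₂ := (mfderiv_pr₁ (Φ.controlMap hΦ ψ hψ q) (mfderiv (controlModel U F)
      (controlModel U' F') (Φ.controlMap hΦ ψ hψ) q ((w, 0) : U × (F →L[ℝ] ℝ)))).symm.trans h₁
    exact (congrArg (fun a : V' × (F' →L[ℝ] ℝ) => a.2) h₂).trans hβ.symm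
  have h := dirDeriv_hamiltonian_controlMap hΦ ψ hψ hσ hL q ((w, 0) : U × (F →L[ℝ] ℝ))
  rw [hΨ] at h
  have hdH : dirDeriv (controlModel U F) C.hamiltonian q y.1.2 = 0 := hq y hy0
  rw [hy] at hdH
  exact h.trans hdH

variable [FiniteDimensional ℝ V] [T2Space M] [FiniteDimensional ℝ V'] [T2Space M']

/-- A test element `y'` at `Ψ(q)` need not be an image under `TΨ`, but it is one modulo `ker 𝒯pr₁`,
on which `dH'` vanishes. It therefore suffices to test on images, where `dH'` becomes `dH` and the
two canonical forms correspond. -/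
lemma symplecticEq_controlMap (hϖ : IsSubmersive ϖ) (hmor : Φ.IsMorphism A A')
    (hsub : FiberwiseSubmersive ϖ ϖ' ψ) {q : ControlTot F E ϖ} (hq : q ∈ C.criticalSet A)
    (z : prol (dualModel V F) A (TotalSpace.proj : DualTot F E → M) (pr₁ q))
    (hz : C.SymplecticEq A q z) :
    C'.SymplecticEq A' (Φ.controlMap hΦ ψ hψ q)
      (prolCast (Φ.pr₁_controlMap hΦ ψ hψ q).symm (prolMap hmor hΦ (pr₁ q) z)) := by
  intro y'
  have h := Φ.pr₁_controlMap hΦ ψ hψ q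
  obtain ⟨x, hx⟩ := (prolMap_bijective hmor hΦ (pr₁ q)).2
    (prolCast h (prolPr₁ A' (Φ.controlMap hΦ ψ hψ q) y'))
  obtain ⟨y, rfl⟩ := prolPr₁_surjective A hϖ q x
  -- `y''` is the image of `y` under the prolongation of `Ψ`; by the choice of `y` it has the same
  -- `𝒯pr₁` as `y'`.
  obtain ⟨y'', hy₁, hy₂⟩ := exists_prolPr₁_eq A' (Φ.controlMap hΦ ψ hψ q)
    (prolPr₁ A' (Φ.controlMap hΦ ψ hψ q) y')
    (mfderiv (controlModel U F) (controlModel U' F') (Φ.controlMap hΦ ψ hψ) q y.1.2) (by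
      have h₁ := mfderiv_pr₁_controlMap (ϖ' := ϖ') hΦ ψ hψ q y.1.2
      have h₂ := congrArg (fun z => (z.1.2 : V' × (F' →L[ℝ] ℝ))) hx
      exact h₁.trans (h₂.trans (prolCast_snd h _)))
  have hker := controlMap_mem_criticalSet (A := A) (A' := A') hΦ ψ hψ hσ hL hsub hq (y' - y'') (by
    have := map_sub (prolPr₁Linear A' (Φ.controlMap hΦ ψ hψ q)) y' y''
    refine this.trans ?_
    rw [sub_eq_zero]; exact hy₂.symm)
  have hdH : C'.dHamiltonian A' (Φ.controlMap hΦ ψ hψ q) y' = C.dHamiltonian A q y := by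
    have h₁ := map_sub (dHamiltonianLinear A' C' (Φ.controlMap hΦ ψ hψ q)) y' y''
    have h₂ := sub_eq_zero.1 (h₁.symm.trans hker)
    refine h₂.trans ?_
    change dirDeriv (controlModel U' F') C'.hamiltonian (Φ.controlMap hΦ ψ hψ q) y''.1.2 =
      dirDeriv (controlModel U F) C.hamiltonian q y.1.2
    rw [hy₁]
    exact dirDeriv_hamiltonian_controlMap hΦ ψ hψ hσ hL q y.1.2
  rw [hdH, ← hz y, ← canonicalForm_prolMap hmor hΦ, hx,
    ← canonicalForm_prolCast h.symm, prolCast_symm_prolCast]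

/-- Both sides solve the symplectic equation at the critical point `Ψ(q)`, and the solution there is
unique. -/
lemma criticalSection_controlMap (hϖ : IsSubmersive ϖ) (hϖ' : IsSubmersive ϖ')
    (hmor : Φ.IsMorphism A A')
    (hsub : FiberwiseSubmersive ϖ ϖ' ψ) {q : ControlTot F E ϖ} (hq : q ∈ C.criticalSet A) :
    C'.criticalSection A' (Φ.controlMap hΦ ψ hψ q) =
      prolCast (Φ.pr₁_controlMap hΦ ψ hψ q).symm
        (prolMap hmor hΦ (pr₁ q) (C.criticalSection A q)) := by
  have hz := Classical.epsilon_spec (existsUnique_symplecticEq A C hϖ q hq).exists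
  have hu := existsUnique_symplecticEq A' C' hϖ' (Φ.controlMap hΦ ψ hψ q)
    (controlMap_mem_criticalSet hΦ ψ hψ hσ hL hsub hq)
  exact hu.unique (Classical.epsilon_spec hu.exists)
    (symplecticEq_controlMap hΦ ψ hψ hσ hL hϖ hmor hsub hq _ hz)

lemma isCriticalTrajectory_controlMap (hϖ : IsSubmersive ϖ) (hϖ' : IsSubmersive ϖ')
    (hmor : Φ.IsMorphism A A') (hsub : FiberwiseSubmersive ϖ ϖ' ψ) {r : ℕ∞} {J : Set ℝ}
    {γ : ℝ → ControlTot F E ϖ} (hγ : C.IsCriticalTrajectory A r J γ) :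
    C'.IsCriticalTrajectory A' r J (fun t => Φ.controlMap hΦ ψ hψ (γ t)) where
  interval := hγ.interval
  nontrivial := hγ.nontrivial
  regular := ((contMDiff_controlMap hΦ ψ hψ).of_le (by exact_mod_cast le_top)).comp_contMDiffOn
    hγ.regular
  mem_criticalSet t ht :=
    controlMap_mem_criticalSet hΦ ψ hψ hσ hL hsub (hγ.mem_criticalSet t ht)
  tangent t ht := by
    have h₁ := ((Φ.contMDiff_contragredient hΦ).mdifferentiableAt
      (x := pr₁ (γ t)) (by simp)).hasMFDerivAt.comp_hasMFDerivWithinAt t (hγ.tangent t ht)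
    have h₂ : Φ.contragredient hΦ ∘ (fun s => pr₁ (γ s)) =
        fun s => pr₁ (Φ.controlMap hΦ ψ hψ (γ s)) :=
      funext fun s => (Φ.pr₁_controlMap hΦ ψ hψ (γ s)).symm
    rw [h₂] at h₁
    have h₃ := criticalSection_controlMap hΦ ψ hψ hσ hL hϖ hϖ' hmor hsub
      (hγ.mem_criticalSet t ht)
    have h₄ := (congrArg (fun z => (z.1.2 : V' × (F' →L[ℝ] ℝ))) h₃).trans (prolCast_snd _ _)
    -- The chain rule gives the velocity `TΦᶜ(ρ(σ_H(γ(t))))`, which is the tangent component of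
    -- `σ_{H'}(Ψ(γ(t)))`.
    refine h₁.congr_mfderiv ?_
    refine ContinuousLinearMap.ext fun (a : ℝ) => ?_
    refine (ContinuousLinearMap.map_smul (mfderiv (dualModel V F) (dualModel V' F')
      (Φ.contragredient hΦ) (pr₁ (γ t))) a _).trans ?_
    exact congrArg (fun w : V' × (F' →L[ℝ] ℝ) => a • w) h₄.symm

end BundleMap

end Reduction

end AlgebroidControl

open AlgebroidControl in
theorem mainTheorem5
    -- the base manifolds `M`, `M'`
    {V : Type*} [NormedAddCommGroup V] [NormedSpace ℝ V] [FiniteDimensional ℝ V]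
    {M : Type*} [TopologicalSpace M] [T2Space M] [ChartedSpace V M] [IsManifold 𝓘(ℝ, V) ∞ M]
    {V' : Type*} [NormedAddCommGroup V'] [NormedSpace ℝ V'] [FiniteDimensional ℝ V']
    {M' : Type*} [TopologicalSpace M'] [T2Space M'] [ChartedSpace V' M']
    [IsManifold 𝓘(ℝ, V') ∞ M']
    -- the vector bundles `E → M`, `E' → M'`, of finite rank
    {F : Type*} [NormedAddCommGroup F] [NormedSpace ℝ F] [FiniteDimensional ℝ F]
    {E : M → Type*} [∀ x, AddCommGroup (E x)] [∀ x, Module ℝ (E x)]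
    [∀ x, TopologicalSpace (E x)] [TopologicalSpace (TotalSpace F E)]
    [FiberBundle F E] [VectorBundle ℝ F E] [ContMDiffVectorBundle ∞ F E 𝓘(ℝ, V)]
    {F' : Type*} [NormedAddCommGroup F'] [NormedSpace ℝ F'] [FiniteDimensional ℝ F']
    {E' : M' → Type*} [∀ x, AddCommGroup (E' x)] [∀ x, Module ℝ (E' x)]
    [∀ x, TopologicalSpace (E' x)] [TopologicalSpace (TotalSpace F' E')]
    [FiberBundle F' E'] [VectorBundle ℝ F' E'] [ContMDiffVectorBundle ∞ F' E' 𝓘(ℝ, V')]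
    -- the control spaces `B → M`, `B' → M'`
    {U : Type*} [NormedAddCommGroup U] [NormedSpace ℝ U] [FiniteDimensional ℝ U]
    {B : Type*} [TopologicalSpace B] [T2Space B] [ChartedSpace U B] [IsManifold 𝓘(ℝ, U) ∞ B]
    {U' : Type*} [NormedAddCommGroup U'] [NormedSpace ℝ U'] [FiniteDimensional ℝ U']
    {B' : Type*} [TopologicalSpace B'] [T2Space B'] [ChartedSpace U' B']
    [IsManifold 𝓘(ℝ, U') ∞ B']
    (ϖ : C^∞⟮𝓘(ℝ, U), B; 𝓘(ℝ, V), M⟯) (hϖ : IsSubmersive ϖ)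
    (ϖ' : C^∞⟮𝓘(ℝ, U'), B'; 𝓘(ℝ, V'), M'⟯) (hϖ' : IsSubmersive ϖ')
    -- the Lie algebroids and the optimal control systems
    (A : LieAlgebroid V F E) (A' : LieAlgebroid V' F' E')
    (C : ControlSystem F E ϖ) (C' : ControlSystem F' E' ϖ')
    -- the fibrewise bijective morphism `Φ` and the fibrewise submersive map `ψ`, over `φ`
    (φ : C^∞⟮𝓘(ℝ, V), M; 𝓘(ℝ, V'), M'⟯)
    (Φ : BundleMap F E F' E' φ) (hΦ : Φ.FiberwiseBijective) (hmor : Φ.IsMorphism A A')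
    (ψ : C^∞⟮𝓘(ℝ, U), B; 𝓘(ℝ, U'), B'⟯) (hψ : ∀ u, ϖ' (ψ u) = φ (ϖ u))
    (hsub : FiberwiseSubmersive ϖ ϖ' ψ)
    -- the two control systems are related: `Φ ∘ σ = σ' ∘ ψ` and `L = L' ∘ ψ`
    (hσ : ∀ u, (⟨φ (ϖ u), Φ.onFiber (ϖ u) (C.section_ u)⟩ : TotalSpace F' E') =
      ⟨ϖ' (ψ u), C'.section_ (ψ u)⟩)
    (hL : ∀ u, C.index u = C'.index (ψ u)) :
    -- the symplectic equations have unique solutions on `S_H` and `S_{H'}`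
    (∀ q ∈ C.criticalSet A, ∃! z, C.SymplecticEq A q z) ∧
    (∀ q' ∈ C'.criticalSet A', ∃! z', C'.SymplecticEq A' q' z') ∧
    -- `Ψ(S_H) ⊆ S_{H'}`
    Φ.controlMap hΦ ψ hψ '' C.criticalSet A ⊆ C'.criticalSet A' ∧
    -- `𝒯^Φ Φᶜ ∘ σ_H = σ_{H'} ∘ Ψ` on `S_H`
    (∀ q ∈ C.criticalSet A,
      Φ.prolContragredient A hΦ (pr₁ q) (C.criticalSection A q) =
        ⟨pr₁ (Φ.controlMap hΦ ψ hψ q),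
          (C'.criticalSection A' (Φ.controlMap hΦ ψ hψ q) :
            E' (pr₁ (Φ.controlMap hΦ ψ hψ q)).proj ×
              TangentSpace (dualModel V' F') (pr₁ (Φ.controlMap hΦ ψ hψ q)))⟩) ∧
    -- `Ψ` maps critical trajectories to critical trajectories
    (∀ (r : ℕ∞) (J : Set ℝ) (γ : ℝ → ControlTot F E ϖ),
      C.IsCriticalTrajectory A r J γ →
        C'.IsCriticalTrajectory A' r J (fun t => Φ.controlMap hΦ ψ hψ (γ t))) := by
  refine ⟨fun q hq => existsUnique_symplecticEq A C hϖ q hq,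
    fun q' hq' => existsUnique_symplecticEq A' C' hϖ' q' hq', ?_, fun q hq => ?_,
    fun r J γ hγ =>
      BundleMap.isCriticalTrajectory_controlMap hΦ ψ hψ hσ hL hϖ hϖ' hmor hsub hγ⟩
  · rintro _ ⟨q, hq, rfl⟩
    exact BundleMap.controlMap_mem_criticalSet hΦ ψ hψ hσ hL hsub hq
  · rw [BundleMap.criticalSection_controlMap hΦ ψ hψ hσ hL hϖ hϖ' hmor hsub hq]
    -- As a triple that includes its base point, a transported element equals the original one, so
    -- the cast disappears.
    exact (sigma_prolCast (Φ.pr₁_controlMap hΦ ψ hψ q).symm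
      (BundleMap.prolMap hmor hΦ (pr₁ q) (C.criticalSection A q))).symm
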